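/- Let $(\Omega,\mathcal A,\mathbb P)$ be a probability space and let $p,q\in[1,+\infty]$ be conjugate exponents ($1/p+1/q=1$). For a Borel probability measure $m$ on $\mathbb R$ put $\mathcal M_p(m)=(\int|x|^p\,dm)^{1/p}$ if $p<\infty$ and $\mathcal M_\infty(m)=\sup_{x\in\operatorname{supp}m}|x|$; let $\mathcal P_p(\mathbb R)$ be the set of those $m$ with $\mathcal M_p(m)<\infty$, and call $R\subset\mathcal P_q(\mathbb R)$ bounded if $\sup_{r\in R}\mathcal M_q(r)<\infty$. For $m\in\mathcal P_p(\mathbb R)$ and $R\subset\mathcal P_q(\mathbb R)$ bounded, let $\Pi(m,R)$ be the set of Borel probability measures on $\mathbb R^2$ with first marginal $m$ and second marginal in $R$, and let $$\chi_R(m)=\sup_{\pi\in\Pi(m,R)}\int_{\mathbb R^2}xy\,d\pi(x,y).$$ For $X\in L^p(\Omega,\mathbb R)$ with law $\mathbb P_X$ put $\rho_R(X)=\chi_R(\mathbb P_X)$. Say that $R$ satisfies (OT) if $R\subset\mathcal P_q(\mathbb R)$ is bounded, $\operatorname{supp}r\subset[0,\infty)$ and $\int x\,dr=1$ for all $r\in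 R$. A map $\rho:L^p(\Omega,\mathbb R)\to\mathbb R$ is coherent if for all $X,X_1,X_2\in L^p(\Omega,\mathbb R)$, $\alpha\in\mathbb R$, $\delta\ge0$, $\theta\in[0,1]$: $\rho(X+\alpha)=\rho(X)+\alpha$; $\rho(\delta X)=\delta\rho(X)$; $\rho(X_1)\le\rho(X_2)$ whenever $X_1\le X_2$ a.s.; and $\rho((1-\theta)X_1+\theta X_2)\le(1-\theta)\rho(X_1)+\theta\rho(X_2)$. It is law-invariant if $\rho(X_1)=\rho(X_2)$ whenever $\mathbb P_{X_1}=\mathbb P_{X_2}$. For $p=\infty$ it has the Fatou property if $\rho(X)\le\liminf_n\rho(X_n)$ whenever $(X_n)$ is bounded in $L^\infty$ and converges in probability to $X\in L^\infty$. The space is nonatomic if every measurable set of positive probability has a measurable subset of strictly smaller positive probability. The transport problem is well posed: for $m\in\mathcal P_p(\mathbb R)$ and $R\subset\mathcal P_q(\mathbb R)$ bounded, $(x,y)\mapsto xy$ is $\pi$-integrable for every $\pi\in\Pi(m,R)$, and $\chi_R(m)<+\infty$. Moreover: **(A)** If the space is nonatomic and $\rho:L^p(\Omega,\mathbb R)\to\mathbb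 R$ is coherent and law-invariant, and has the Fatou property in case $p=\infty$, then there is a set $R$ satisfying (OT) such that $\rho(X)=\chi_R(\mathbb P_X)$ for every $X\in L^p(\Omega,\mathbb R)$. **(B)** Let $\rho:L^p(\Omega,\mathbb R)\to\mathbb R$ be coherent, with the Fatou property in case $p=\infty$. Let $\mathfrak Y\subset L^q(\Omega,\mathbb R)$ be any bounded set of nonnegative random variables with expectation $1$ such that $\rho(X)=\sup_{Y\in\mathfrak Y}\mathbb E[XY]$ for all $X\in L^p(\Omega,\mathbb R)$, and let $R=\{\mathbb P_Y: Y\in\mathfrak Y\}$. Then $R$ satisfies (OT) and $\rho(X)\le\rho_R(X)$ for all $X\in L^p(\Omega,\mathbb R)$. If moreover the space is nonatomic, then $$\sup\{\rho(X'): X'\in L^p(\Omega,\mathbb R),\ \mathbb P_{X'}=\mathbb P_X\}=\rho_R(X)\qquad\text{for all }X\in L^p(\Omega,\mathbb R),$$ and in particular, if in addition $\rho$ is law-invariant, then $\rho=\rho_R$. -/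

import Mathlib

open MeasureTheory Filter
open scoped ENNReal Topology

namespace Licorm

section Measures

/-- The `p`-moment `M_p(m)` of a Borel measure on the line, in `[0,∞]`: `(∫ |x|^p dm)^(1/p)` when
`p < ∞`, and the supremum of `|x|` over the support of `m` when `p = ∞`. -/
noncomputable def moment (p : ℝ≥0∞) (m : Measure ℝ) : ℝ≥0∞ :=
  open Classical in
  if p = ∞ then ⨆ x ∈ m.support, ENNReal.ofReal |x|
  else (∫⁻ x, ENNReal.ofReal |x| ^ p.toReal ∂m) ^ (1 / p.toReal)

/-- The set `P_p(ℝ)` of Borel probability measures on the line with finite `p`-moment. -/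
def finiteMoment (p : ℝ≥0∞) : Set (Measure ℝ) :=
  {m | IsProbabilityMeasure m ∧ moment p m < ∞}

/-- `R` is a bounded subset of `P_q(ℝ)`: it is contained in `P_q(ℝ)` and the supremum over `R` of
the `q`-moments is finite. -/
def IsBoundedFamily (q : ℝ≥0∞) (R : Set (Measure ℝ)) : Prop :=
  R ⊆ finiteMoment q ∧ ⨆ r ∈ R, moment q r < ∞

/-- The union of the supports of the members of `R` lies in `[0,∞)`, and each member of `R` has
expectation `1`. -/
def IsNonnegUnitMean (R : Set (Measure ℝ)) : Prop :=
  (⋃ r ∈ R, r.support) ⊆ Set.Ici 0 ∧ ∀ r ∈ R, ∫ x, x ∂r = 1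

/-- The set `Π(m,R)` of Borel probability measures on the plane with first marginal `m` and second
marginal in `R`. -/
def plans (m : Measure ℝ) (R : Set (Measure ℝ)) : Set (Measure (ℝ × ℝ)) :=
  {π | IsProbabilityMeasure π ∧ π.map Prod.fst = m ∧ π.map Prod.snd ∈ R}

/-- The value `χ_R(m) = sup {∫ x y dπ : π ∈ Π(m,R)}` of the generalized transport problem, the
supremum being taken in the extended reals. -/
noncomputable def chi (R : Set (Measure ℝ)) (m : Measure ℝ) : EReal :=
  ⨆ π ∈ plans m R, ((∫ z, z.1 * z.2 ∂π : ℝ) : EReal)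

end Measures

section RiskMeasures

variable {Ω : Type*} [MeasurableSpace Ω]

/-- A measure is nonatomic when every measurable set of positive measure has a measurable subset
of strictly smaller positive measure. (Vanishing on singletons would be weaker in general.) -/
def Nonatomic (P : Measure Ω) : Prop :=
  ∀ A, MeasurableSet A → 0 < P A → ∃ B ⊆ A, MeasurableSet B ∧ 0 < P B ∧ P B < P A

/-- The law of a random variable. -/
noncomputable def law {P : Measure Ω} {p : ℝ≥0∞} (X : Lp ℝ p P) : Measure ℝ :=
  P.map X

/-- Coherent risk measures `ρ : L^p(Ω,ℝ) → ℝ`. -/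
structure IsCoherent {P : Measure Ω} [IsProbabilityMeasure P] {p : ℝ≥0∞}
    (ρ : Lp ℝ p P → ℝ) : Prop where
  translation : ∀ (X : Lp ℝ p P) (α : ℝ), ρ (X + Lp.const p P α) = ρ X + α
  homogeneous : ∀ (X : Lp ℝ p P) (δ : ℝ), 0 ≤ δ → ρ (δ • X) = δ * ρ X
  monotone : ∀ X₁ X₂ : Lp ℝ p P, (∀ᵐ ω ∂P, X₁ ω ≤ X₂ ω) → ρ X₁ ≤ ρ X₂
  convex : ∀ (X₁ X₂ : Lp ℝ p P) (θ : ℝ), θ ∈ Set.Icc (0 : ℝ) 1 →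
    ρ ((1 - θ) • X₁ + θ • X₂) ≤ (1 - θ) * ρ X₁ + θ * ρ X₂

/-- Law invariance: `ρ X` depends only on the law of `X`. -/
def IsLawInvariant {P : Measure Ω} {p : ℝ≥0∞} (ρ : Lp ℝ p P → ℝ) : Prop :=
  ∀ X₁ X₂ : Lp ℝ p P, law X₁ = law X₂ → ρ X₁ = ρ X₂

/-- The Fatou property: lower semicontinuity of `ρ` along norm-bounded sequences that converge in
probability. It is only used for `p = ∞`. The lower limit is taken in the extended reals. -/
def HasFatouProperty {P : Measure Ω} {p : ℝ≥0∞} (ρ : Lp ℝ p P → ℝ) : Prop :=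
  ∀ (Xs : ℕ → Lp ℝ p P) (X : Lp ℝ p P), (∃ C : ℝ, ∀ n, ‖Xs n‖ ≤ C) →
    TendstoInMeasure P (fun n => (Xs n : Ω → ℝ)) atTop (X : Ω → ℝ) →
    (ρ X : EReal) ≤ liminf (fun n => (ρ (Xs n) : EReal)) atTop

/-- `𝔜` is a dual set of `ρ`: a bounded subset of `L^q` of nonnegative random variables with
expectation `1` such that `ρ X = sup {E[X Y] : Y ∈ 𝔜}` for every `X`. -/
structure IsDualSet {P : Measure Ω} {p q : ℝ≥0∞} (ρ : Lp ℝ p P → ℝ)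
    (𝔜 : Set (Lp ℝ q P)) : Prop where
  bounded : ∃ C : ℝ, ∀ Y ∈ 𝔜, ‖Y‖ ≤ C
  nonneg : ∀ Y ∈ 𝔜, ∀ᵐ ω ∂P, 0 ≤ Y ω
  mean_one : ∀ Y ∈ 𝔜, ∫ ω, Y ω ∂P = 1
  represents : ∀ X : Lp ℝ p P,
    IsLUB ((fun Y : Lp ℝ q P => ∫ ω, X ω * Y ω ∂P) '' 𝔜) (ρ X)

/-- The value `ρ_R(X) = χ_R(P_X)` of the transport-based risk measure. -/
noncomputable def transportRisk {P : Measure Ω} {p : ℝ≥0∞} (R : Set (Measure ℝ))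
    (X : Lp ℝ p P) : EReal :=
  chi R (law X)

end RiskMeasures

end Licorm

namespace Licorm

/-! ### Intermediate values of nonatomic measures -/

section NonatomicSpaces

variable {Ω : Type*} [MeasurableSpace Ω] {P : Measure Ω}

/-! Transport and duality meet because the joint law of `X` and `Y` is a transport plan; this gives
`ρ ≤ ρ_R`. Conversely, on a nonatomic space a plan `π` whose second marginal is the law of `Y` is
almost realized by a pair `(X', Y)`. Exact realization may fail, since `Y` can use up all the
randomness. The fibres of `⌊Y / ε⌋`, however, are countably many and inherit nonatomicity, so `X'`
can be drawn jointly with `⌊Y / ε⌋` as `π` prescribes, at a cost of order `ε`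
(`Nonatomic.exists_law_eq_integral_mul_ge`). The randomness comes from Sierpiński's theorem, which
realizes any standard Borel law on each fibre (`Nonatomic.exists_measurable_map_restrict_eq`).

For (A) it remains to produce a dual set. If `X` is a function of a finitely valued `κ`, Hahn–Banach
gives a linear `f ≤ ρ` touching `ρ` at `X`. Such an `f` need not have a density, but `Z ↦ f (E[Z |
κ])` has one, agrees with `f` at `X`, and stays below `ρ` because `ρ (E[Z | κ]) ≤ ρ Z`
(`IsCoherent.apply_setAverage_le`). The last inequality holds because `E[Z | κ]` is the almost sure
limit of averages of copies of `Z` that are independent given `κ`: subadditivity, homogeneity and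
law invariance control the averages, and the Fatou property or norm continuity controls the limit.
Density of simple functions and the bound `IsCoherent.exists_le_mul_norm` extend the representation
to every `X`. -/

lemma Nonatomic.exists_subset_le_half [IsFiniteMeasure P] (h : Nonatomic P) {A : Set Ω}
    (hA : MeasurableSet A) (hpos : 0 < P A) :
    ∃ B ⊆ A, MeasurableSet B ∧ 0 < P B ∧ P B ≤ P A / 2 := by
  obtain ⟨B, hBA, hB, hB0, hlt⟩ := h A hA hpos
  have hsum : P B + P (A \ B) = P A := by
    rw [add_comm, ← measure_sdiff_add_inter A hB, Set.inter_eq_right.2 hBA]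
  rcases le_total (P B) (P A / 2) with hle | hle
  · exact ⟨B, hBA, hB, hB0, hle⟩
  · refine ⟨A \ B, Set.sdiff_subset, hA.diff hB, ?_, ?_⟩
    · rw [pos_iff_ne_zero]
      intro h0
      rw [h0, add_zero] at hsum
      exact hlt.ne hsum
    · by_contra! hgt
      have := ENNReal.add_lt_add_of_le_of_lt (ne_top_of_le_ne_top (measure_ne_top P B) hle) hle hgt
      rw [ENNReal.add_halves, hsum] at this
      exact lt_irrefl _ this

lemma Nonatomic.exists_subset_le [IsFiniteMeasure P] (h : Nonatomic P) {A : Set Ω}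
    (hA : MeasurableSet A) (hpos : 0 < P A) {ε : ℝ≥0∞} (hε : 0 < ε) :
    ∃ B ⊆ A, MeasurableSet B ∧ 0 < P B ∧ P B ≤ ε := by
  have key : ∀ n : ℕ, ∃ B ⊆ A, MeasurableSet B ∧ 0 < P B ∧ P B ≤ P A * 2⁻¹ ^ n := by
    intro n
    induction n with
    | zero => exact ⟨A, subset_rfl, hA, hpos, by simp⟩
    | succ n ih =>
      obtain ⟨B, hBA, hB, hB0, hle⟩ := ih
      obtain ⟨C, hCB, hC, hC0, hCle⟩ := h.exists_subset_le_half hB hB0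
      refine ⟨C, hCB.trans hBA, hC, hC0, hCle.trans ?_⟩
      rw [pow_succ, ← mul_assoc, ENNReal.div_eq_inv_mul, mul_comm]
      gcongr
  have hlim : Tendsto (fun n : ℕ => P A * (2⁻¹ : ℝ≥0∞) ^ n) atTop (𝓝 (P A * 0)) :=
    ENNReal.Tendsto.const_mul (ENNReal.tendsto_pow_atTop_nhds_zero_of_lt_one (by simp))
      (Or.inr (measure_ne_top _ _))
  rw [mul_zero] at hlim
  obtain ⟨n, hn⟩ := (hlim.eventually (gt_mem_nhds hε)).exists
  obtain ⟨B, h1, h2, h3, h4⟩ := key n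
  exact ⟨B, h1, h2, h3, h4.trans hn.le⟩

/-- Among the subsets of `A \ B` which may be added to `B` without exceeding the measure `t`, there
is one that has at least half of the measure of any other. -/
lemma exists_greedy_subset {A B : Set Ω} {t : ℝ≥0∞} (ht : t ≠ ∞) (hBt : P B ≤ t) :
    ∃ C ⊆ A \ B, MeasurableSet C ∧ P B + P C ≤ t ∧
      ∀ D ⊆ A \ B, MeasurableSet D → P B + P D ≤ t → P D ≤ 2 * P C := by
  set F : Set (Set Ω) := {D | D ⊆ A \ B ∧ MeasurableSet D ∧ P B + P D ≤ t} with hF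
  set s := ⨆ D ∈ F, P D with hs
  have hle : ∀ D ∈ F, P D ≤ s := fun D hD => le_iSup₂ (f := fun D (_ : D ∈ F) => P D) D hD
  have hst : s ≤ t := iSup₂_le fun D hD => le_add_self.trans hD.2.2
  rcases eq_or_ne s 0 with h0 | h0
  · refine ⟨∅, Set.empty_subset _, .empty, by simpa, fun D h1 h2 h3 => ?_⟩
    have := hle D ⟨h1, h2, h3⟩
    rw [h0] at this
    exact this.trans zero_le
  · have hlt : s / 2 < s := ENNReal.half_lt_self h0 (ne_top_of_le_ne_top ht hst)
    obtain ⟨C, hC⟩ := lt_iSup_iff.1 (hs ▸ hlt)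
    obtain ⟨hCF, hC⟩ := lt_iSup_iff.1 hC
    refine ⟨C, hCF.1, hCF.2.1, hCF.2.2, fun D h1 h2 h3 => ?_⟩
    calc P D ≤ s := hle D ⟨h1, h2, h3⟩
      _ = 2 * (s / 2) := (ENNReal.mul_div_cancel (by simp) (by simp)).symm
      _ ≤ 2 * P C := by gcongr

/-- Sierpiński's theorem: a nonatomic finite measure takes every intermediate value. -/
theorem Nonatomic.exists_subset_eq [IsFiniteMeasure P] (h : Nonatomic P) {A : Set Ω}
    (hA : MeasurableSet A) {t : ℝ≥0∞} (ht : t ≤ P A) :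
    ∃ B ⊆ A, MeasurableSet B ∧ P B = t := by
  have htop : t ≠ ∞ := ne_top_of_le_ne_top (measure_ne_top _ _) ht
  let S := {B : Set Ω // B ⊆ A ∧ MeasurableSet B ∧ P B ≤ t}
  choose C hCsub hCmeas hCle hCmax using
    fun B : S => exists_greedy_subset (A := A) htop B.2.2.2
  have hdisj : ∀ B : S, P (B.1 ∪ C B) = P B.1 + P (C B) := fun B =>
    measure_union (Set.disjoint_sdiff_right.mono_right (hCsub B)) (hCmeas B)
  let next : S → S := fun B => ⟨B.1 ∪ C B, Set.union_subset B.2.1 ((hCsub B).trans Set.sdiff_subset),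
    B.2.2.1.union (hCmeas B), (hdisj B).trans_le (hCle B)⟩
  let B : ℕ → S := fun n => next^[n] ⟨∅, Set.empty_subset _, .empty, by simp⟩
  have hB : ∀ n, B (n + 1) = next (B n) := fun n => Function.iterate_succ_apply' _ _ _
  have hmono : Monotone fun n => (B n).1 := monotone_nat_of_le_succ fun n => by
    rw [hB]; exact Set.subset_union_left
  have hmeas : MeasurableSet (⋃ n, (B n).1) := .iUnion fun n => (B n).2.2.1
  have hle : P (⋃ n, (B n).1) ≤ t := by
    rw [hmono.measure_iUnion]
    exact iSup_le fun n => (B n).2.2.2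
  refine ⟨⋃ n, (B n).1, Set.iUnion_subset fun n => (B n).2.1, hmeas, ?_⟩
  by_contra hne
  have hlt := lt_of_le_of_ne hle hne
  have hpos : 0 < P (A \ ⋃ n, (B n).1) :=
    (tsub_pos_of_lt (hlt.trans_le ht)).trans_le le_measure_sdiff
  -- If the exhaustion stops short of `t`, this `D` fits into the remaining gap, so it was
  -- admissible at every stage and each greedy step added at least `P D / 2`. The total then exceeds
  -- `t`.
  obtain ⟨D, hDsub, hD, hD0, hDle⟩ := h.exists_subset_le (hA.diff hmeas) hpos (tsub_pos_of_lt hlt)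
  have hgrow : ∀ n : ℕ, n * (P D / 2) ≤ P (B n).1 := by
    intro n
    induction n with
    | zero => simp
    | succ n ih =>
      have hmax := hCmax (B n) D
        (hDsub.trans (Set.sdiff_subset_sdiff_right (Set.subset_iUnion (fun n => (B n).1) n))) hD (by
          calc P (B n).1 + P D ≤ P (⋃ n, (B n).1) + (t - P (⋃ n, (B n).1)) := by
                gcongr; exact Set.subset_iUnion (fun n => (B n).1) n
            _ = t := add_tsub_cancel_of_le hle)
      rw [hB]
      change _ ≤ P ((B n).1 ∪ C (B n))
      rw [hdisj]
      push_cast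
      rw [add_mul, one_mul]
      gcongr
      exact ENNReal.div_le_of_le_mul' hmax
  obtain ⟨n, hn⟩ := ENNReal.exists_nat_mul_gt (a := P D / 2) (b := t)
    (ENNReal.half_pos hD0.ne').ne' htop
  exact absurd (hn.trans_le ((hgrow n).trans (B n).2.2.2)) (lt_irrefl _)

lemma Nonatomic.restrict (h : Nonatomic P) {A : Set Ω} (hA : MeasurableSet A) :
    Nonatomic (P.restrict A) := by
  intro B hB hpos
  rw [Measure.restrict_apply hB] at hpos
  obtain ⟨C, hCsub, hC, hC0, hlt⟩ := h _ (hB.inter hA) hpos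
  refine ⟨C, hCsub.trans Set.inter_subset_left, hC, ?_, ?_⟩ <;>
  simpa [Measure.restrict_apply, hB, hC, Set.inter_eq_left.2 (hCsub.trans Set.inter_subset_right)]

end NonatomicSpaces

/-! ### Realizing prescribed laws on nonatomic spaces -/

section Realization

/-- The first `n` terms of a sequence, the last one first. -/
def prefixList {α : Type*} (x : ℕ → α) : ℕ → List α
  | 0 => []
  | n + 1 => x n :: prefixList x n

/-- The sequences which start with the reverse of `w`. -/
def cylinderOf {α : Type*} (w : List α) : Set (ℕ → α) := {x | prefixList x w.length = w}

lemma length_prefixList {α : Type*} (x : ℕ → α) (n : ℕ) : (prefixList x n).length = n := by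
  induction n with
  | zero => rfl
  | succ n ih => simp [prefixList, ih]

lemma prefixList_eq_of_le {α : Type*} {x y : ℕ → α} {m n : ℕ} (hmn : m ≤ n)
    (h : prefixList x n = prefixList y n) : prefixList x m = prefixList y m := by
  induction n, hmn using Nat.le_induction with
  | base => exact h
  | succ n _ ih => exact ih (List.cons_eq_cons.1 h).2

lemma mem_cylinderOf_cons {α : Type*} {a : α} {w : List α} {x : ℕ → α} :
    x ∈ cylinderOf (a :: w) ↔ x w.length = a ∧ x ∈ cylinderOf w := by
  simp [cylinderOf, prefixList]

lemma measurableSet_cylinderOf (w : List Bool) : MeasurableSet (cylinderOf w) := by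
  induction w with
  | nil => simp [cylinderOf, prefixList]
  | cons a w ih =>
    have : cylinderOf (a :: w) = {x | x w.length = a} ∩ cylinderOf w := by
      ext x; exact mem_cylinderOf_cons
    rw [this]
    exact (measurable_pi_apply w.length (measurableSet_singleton a)).inter ih

/-- Two cylinders with a common point are nested: the longer word determines the shorter. -/
lemma isPiSystem_cylinderOf : IsPiSystem (Set.range (cylinderOf (α := Bool))) := by
  rintro _ ⟨v, rfl⟩ _ ⟨w, rfl⟩ ⟨x, hxv, hxw⟩
  wlog hle : v.length ≤ w.length generalizing v w
  · rw [Set.inter_comm]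
    exact this w v hxw hxv (le_of_not_ge hle)
  refine ⟨w, (Set.inter_eq_right.2 fun y hy => ?_).symm⟩
  exact (prefixList_eq_of_le hle (hy.trans hxw.symm)).trans hxv

lemma generateFrom_cylinderOf :
    MeasurableSpace.generateFrom (Set.range (cylinderOf (α := Bool))) = MeasurableSpace.pi := by
  apply le_antisymm
  · refine MeasurableSpace.generateFrom_le ?_
    rintro _ ⟨w, rfl⟩
    exact measurableSet_cylinderOf w
  · refine iSup_le fun n => ?_
    rw [← measurable_iff_comap_le]
    refine measurable_to_bool ?_
    have : (fun x : ℕ → Bool => x n) ⁻¹' {true} =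
        ⋃ w ∈ {w : List Bool | w.length = n}, cylinderOf (true :: w) := by
      ext x
      simp only [Set.mem_preimage, Set.mem_singleton_iff, Set.mem_iUnion, mem_cylinderOf_cons]
      constructor
      · intro hx
        exact ⟨prefixList x n, length_prefixList x n, by rwa [length_prefixList],
          by simp [cylinderOf, length_prefixList]⟩
      · rintro ⟨w, rfl, h, -⟩
        exact h
    rw [this]
    exact .biUnion (Set.to_countable _) fun w _ =>
      MeasurableSpace.measurableSet_generateFrom ⟨_, rfl⟩

variable {Ω : Type*} [MeasurableSpace Ω] {P : Measure Ω}

/-- Sierpiński's theorem splits `Ω` along the binary tree into sets with the masses of the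
cylinders; `T ω` records the branch through `ω`. -/
lemma Nonatomic.exists_measurable_map_eq_natBool [IsFiniteMeasure P] (h : Nonatomic P)
    (μ : Measure (ℕ → Bool)) (hμ : μ Set.univ = P Set.univ) :
    ∃ T : Ω → ℕ → Bool, Measurable T ∧ P.map T = μ := by
  classical
  -- The default `∅` makes the splitting total, so the tree can be defined by plain recursion before
  -- measurability and masses are checked.
  have hsplit : ∀ (A : Set Ω) (t : ℝ≥0∞), ∃ B ⊆ A, MeasurableSet A → t ≤ P A →
      MeasurableSet B ∧ P B = t := by
    intro A t
    by_cases hAt : MeasurableSet A ∧ t ≤ P A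
    · obtain ⟨B, hB⟩ := h.exists_subset_eq hAt.1 hAt.2
      exact ⟨B, hB.1, fun _ _ => hB.2⟩
    · exact ⟨∅, Set.empty_subset _, fun h1 h2 => absurd ⟨h1, h2⟩ hAt⟩
  choose split hsub hsplit using hsplit
  let A : List Bool → Set Ω := fun w => List.rec Set.univ (fun a w Aw =>
    if a then split Aw (μ (cylinderOf (true :: w)))
      else Aw \ split Aw (μ (cylinderOf (true :: w)))) w
  have hAtrue : ∀ w, A (true :: w) = split (A w) (μ (cylinderOf (true :: w))) := fun w => rfl
  have hAfalse : ∀ w, A (false :: w) = A w \ A (true :: w) := fun w => rfl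
  have hμsplit : ∀ w, μ (cylinderOf (true :: w)) + μ (cylinderOf (false :: w))
      = μ (cylinderOf w) := by
    intro w
    rw [← measure_union _ (measurableSet_cylinderOf _)]
    · congr 1
      ext x
      cases hx : x w.length <;> simp [mem_cylinderOf_cons, hx]
    · rw [Set.disjoint_left]
      intro x hx hx'
      rw [mem_cylinderOf_cons] at hx hx'
      simp [hx.1] at hx'
  have : IsFiniteMeasure μ := ⟨hμ ▸ measure_lt_top P _⟩
  have hA : ∀ w, MeasurableSet (A w) ∧ P (A w) = μ (cylinderOf w) := by
    intro w
    induction w with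
    | nil => exact ⟨.univ, by simp [cylinderOf, prefixList, hμ, A]⟩
    | cons a w ih =>
      have h1 := hsplit (A w) (μ (cylinderOf (true :: w))) ih.1
        ((le_self_add.trans_eq (hμsplit w)).trans_eq ih.2.symm)
      cases a with
      | true => exact h1
      | false =>
        rw [hAfalse, hAtrue]
        refine ⟨ih.1.diff h1.1, ?_⟩
        rw [measure_sdiff (hsub _ _) h1.1.nullMeasurableSet (measure_ne_top _ _), h1.2, ih.2,
          ← hμsplit, ENNReal.add_sub_cancel_left (measure_ne_top _ _)]
  let path : Ω → ℕ → List Bool := fun ω n =>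
    Nat.rec [] (fun _ w => decide (ω ∈ A (true :: w)) :: w) n
  let T : Ω → ℕ → Bool := fun ω n => decide (ω ∈ A (true :: path ω n))
  have hpath : ∀ ω n, prefixList (T ω) n = path ω n := by
    intro ω n
    induction n with
    | zero => rfl
    | succ n ih => rw [prefixList, ih]
  have hpre : ∀ w, T ⁻¹' cylinderOf w = A w := by
    intro w
    induction w with
    | nil => simp [cylinderOf, prefixList, A]
    | cons a w ih =>
      ext ω
      have ihω : ω ∈ T ⁻¹' cylinderOf w ↔ ω ∈ A w := by rw [ih]
      rw [Set.mem_preimage, mem_cylinderOf_cons, ← Set.mem_preimage, ihω]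
      have key : ω ∈ A w → T ω w.length = decide (ω ∈ A (true :: w)) := by
        intro hω
        have hw : path ω w.length = w := (hpath ω _).symm.trans (ihω.2 hω)
        change decide (ω ∈ A (true :: path ω w.length)) = _
        rw [hw]
      constructor
      · rintro ⟨h1, h2⟩
        rw [key h2] at h1
        cases a with
        | true => simpa using h1
        | false => exact hAfalse w ▸ ⟨h2, by simpa using h1⟩
      · intro hω
        cases a with
        | true =>
          have h2 : ω ∈ A w := hsub _ _ hω
          exact ⟨by simpa [key h2] using hω, h2⟩
        | false =>
          rw [hAfalse] at hω
          exact ⟨by simpa [key hω.1] using hω.2, hω.1⟩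
  have hT : Measurable T := by
    rw [measurable_iff_comap_le, ← generateFrom_cylinderOf, ← measurable_iff_comap_le]
    refine measurable_generateFrom ?_
    rintro _ ⟨w, rfl⟩
    rw [hpre]
    exact (hA w).1
  refine ⟨T, hT, ?_⟩
  refine ext_of_generate_finite _ generateFrom_cylinderOf.symm isPiSystem_cylinderOf ?_ ?_
  · rintro _ ⟨w, rfl⟩
    rw [Measure.map_apply hT (measurableSet_cylinderOf w), hpre, (hA w).2]
  · rw [Measure.map_apply hT .univ, Set.preimage_univ, hμ]

/-- On a nonatomic space, every law on a standard Borel space is the law of a random variable. -/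
theorem Nonatomic.exists_measurable_map_eq {S : Type*} [MeasurableSpace S] [StandardBorelSpace S]
    [Nonempty S] [IsFiniteMeasure P] (h : Nonatomic P) (μ : Measure S)
    (hμ : μ Set.univ = P Set.univ) : ∃ T : Ω → S, Measurable T ∧ P.map T = μ := by
  have he : MeasurableEmbedding (MeasurableSpace.mapNatBool S) :=
    (MeasurableSpace.measurable_mapNatBool S).measurableEmbedding
      (MeasurableSpace.injective_mapNatBool S)
  obtain ⟨T, hT, hmap⟩ := h.exists_measurable_map_eq_natBool
    (μ.map (MeasurableSpace.mapNatBool S)) (by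
      rw [Measure.map_apply he.measurable .univ, Set.preimage_univ, hμ])
  refine ⟨he.invFun ∘ T, he.measurable_invFun.comp hT, ?_⟩
  rw [← Measure.map_map he.measurable_invFun hT, hmap,
    Measure.map_map he.measurable_invFun he.measurable]
  rw [he.leftInverse_invFun.comp_eq_id, Measure.map_id]

/-- On a nonatomic space, a random variable can be chosen with prescribed laws on the level sets of
a given discrete random variable. -/
theorem Nonatomic.exists_measurable_map_restrict_eq {S ι : Type*} [MeasurableSpace S]
    [StandardBorelSpace S] [Nonempty S] [Countable ι] [MeasurableSpace ι]
    [MeasurableSingletonClass ι] [IsFiniteMeasure P] (h : Nonatomic P) {κ : Ω → ι}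
    (hκ : Measurable κ) (μ : ι → Measure S)
    (hμ : ∀ k, μ k Set.univ = P (κ ⁻¹' {k})) :
    ∃ T : Ω → S, Measurable T ∧ ∀ k, (P.restrict (κ ⁻¹' {k})).map T = μ k := by
  have hk : ∀ k, MeasurableSet (κ ⁻¹' {k}) := fun k => hκ (measurableSet_singleton k)
  choose T hT hmap using fun k => (h.restrict (hk k)).exists_measurable_map_eq (μ k) (by
    rw [hμ, Measure.restrict_apply_univ])
  have hmeas : Measurable fun ω => T (κ ω) ω :=
    (measurable_from_prod_countable_right (f := fun z : ι × Ω => T z.1 z.2) hT).comp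
      (hκ.prodMk measurable_id)
  refine ⟨_, hmeas, fun k => ?_⟩
  rw [← hmap k]
  refine Measure.map_congr ?_
  filter_upwards [ae_restrict_mem (hk k)] with ω hω
  rw [show κ ω = k from hω]

end Realization

/-! ### Moments, Hölder bounds and well-posedness -/

section Moments

/-- For `p = ∞`: the closed set where `|y|` is at most the essential supremum has full measure,
hence contains the support; conversely the support itself has full measure. -/
lemma moment_eq_eLpNorm {p : ℝ≥0∞} (hp : p ≠ 0) (m : Measure ℝ) :
    moment p m = eLpNorm (fun x : ℝ => x) p m := by
  rw [moment]
  split_ifs with h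
  · subst h
    simp_rw [← Real.enorm_eq_ofReal_abs]
    rw [eLpNorm_exponent_top]
    apply le_antisymm
    · refine iSup₂_le fun x hx => ?_
      have hclosed : IsClosed {y : ℝ | ‖y‖ₑ ≤ eLpNormEssSup (fun x : ℝ => x) m} :=
        isClosed_le continuous_enorm continuous_const
      exact Measure.support_subset_of_isClosed hclosed (enorm_ae_le_eLpNormEssSup _ m) hx
    · refine essSup_le_of_ae_le _ ?_
      filter_upwards [m.support_mem_ae] with x hx
      exact le_iSup₂ (f := fun (x : ℝ) (_ : x ∈ m.support) => ‖x‖ₑ) x hx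
  · rw [eLpNorm_eq_lintegral_rpow_enorm_toReal hp h]
    simp_rw [Real.enorm_eq_ofReal_abs]

lemma eLpNorm_eq_moment_map {E : Type*} [MeasurableSpace E] {π : Measure E} {p : ℝ≥0∞}
    (hp : p ≠ 0) {f : E → ℝ} (hf : Measurable f) : eLpNorm f p π = moment p (π.map f) := by
  rw [moment_eq_eLpNorm hp, eLpNorm_map_measure (by fun_prop) hf.aemeasurable]
  rfl

lemma memLp_of_map_mem_finiteMoment {E : Type*} [MeasurableSpace E] {π : Measure E} {p : ℝ≥0∞}
    (hp : p ≠ 0) {f : E → ℝ} (hf : Measurable f) (h : π.map f ∈ finiteMoment p) :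
    MemLp f p π := by
  refine ⟨hf.aestronglyMeasurable, ?_⟩
  rw [eLpNorm_eq_moment_map hp hf]
  exact h.2

lemma abs_integral_mul_le {E : Type*} [MeasurableSpace E] {π : Measure E} {p q : ℝ≥0∞}
    (hpq : ENNReal.HolderConjugate p q) {f g : E → ℝ} (hf : MemLp f p π) (hg : MemLp g q π) :
    |∫ z, f z * g z ∂π| ≤ (eLpNorm f p π * eLpNorm g q π).toReal := by
  have h1 : eLpNorm (f • g) 1 π ≤ eLpNorm f p π * eLpNorm g q π :=
    eLpNorm_smul_le_mul_eLpNorm hg.1 hf.1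
  calc |∫ z, f z * g z ∂π| ≤ ∫ z, ‖(f * g) z‖ ∂π :=
        norm_integral_le_integral_norm fun z => f z * g z
    _ = (eLpNorm (f • g) 1 π).toReal := by
        rw [integral_norm_eq_lintegral_enorm (hf.1.mul hg.1), eLpNorm_one_eq_lintegral_enorm]
        rfl
    _ ≤ _ := ENNReal.toReal_mono (ENNReal.mul_ne_top hf.2.ne hg.2.ne) h1

section WellPosed

variable {p q : ℝ≥0∞} {R : Set (Measure ℝ)} {m : Measure ℝ} {π : Measure (ℝ × ℝ)}

lemma memLp_fst_of_mem_plans (hp : p ≠ 0) (hm : m ∈ finiteMoment p) (hπ : π ∈ plans m R) :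
    MemLp Prod.fst p π :=
  memLp_of_map_mem_finiteMoment hp measurable_fst (hπ.2.1.symm ▸ hm)

lemma memLp_snd_of_mem_plans (hq : q ≠ 0) (hR : IsBoundedFamily q R) (hπ : π ∈ plans m R) :
    MemLp Prod.snd q π :=
  memLp_of_map_mem_finiteMoment hq measurable_snd (hR.1 hπ.2.2)

lemma integrable_mul_of_mem_plans (hpq : ENNReal.HolderConjugate p q) (hR : IsBoundedFamily q R)
    (hm : m ∈ finiteMoment p) (hπ : π ∈ plans m R) :
    Integrable (fun z : ℝ × ℝ => z.1 * z.2) π :=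
  (memLp_fst_of_mem_plans (ENNReal.HolderConjugate.ne_zero p q) hm hπ).integrable_mul
    (memLp_snd_of_mem_plans (ENNReal.HolderConjugate.ne_zero q p) hR hπ)

lemma chi_lt_top (hpq : ENNReal.HolderConjugate p q) (hR : IsBoundedFamily q R)
    (hm : m ∈ finiteMoment p) : chi R m < ⊤ := by
  have hp : p ≠ 0 := ENNReal.HolderConjugate.ne_zero p q
  have hq : q ≠ 0 := ENNReal.HolderConjugate.ne_zero q p
  refine lt_of_le_of_lt (b := (((moment p m * ⨆ r ∈ R, moment q r).toReal : ℝ) : EReal))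
    (iSup₂_le fun π hπ => ?_) (EReal.coe_lt_top _)
  rw [EReal.coe_le_coe_iff]
  refine (le_abs_self _).trans ((abs_integral_mul_le hpq (memLp_fst_of_mem_plans hp hm hπ)
    (memLp_snd_of_mem_plans hq hR hπ)).trans ?_)
  refine ENNReal.toReal_mono (ENNReal.mul_ne_top hm.2.ne hR.2.ne) ?_
  rw [eLpNorm_eq_moment_map hp measurable_fst, eLpNorm_eq_moment_map hq measurable_snd, hπ.2.1]
  gcongr
  exact le_iSup₂ (f := fun r (_ : r ∈ R) => moment q r) _ hπ.2.2

end WellPosed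

variable {Ω : Type*} [MeasurableSpace Ω] {P : Measure Ω} {p q : ℝ≥0∞}

lemma measurable_coe_lp (X : Lp ℝ p P) : Measurable X := (Lp.stronglyMeasurable X).measurable

lemma moment_law (hp : p ≠ 0) (X : Lp ℝ p P) : moment p (law X) = eLpNorm X p P :=
  (eLpNorm_eq_moment_map hp (measurable_coe_lp X)).symm

lemma law_mem_finiteMoment [IsProbabilityMeasure P] (hp : p ≠ 0) (X : Lp ℝ p P) :
    law X ∈ finiteMoment p :=
  ⟨Measure.isProbabilityMeasure_map (measurable_coe_lp X).aemeasurable,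
    moment_law hp X ▸ Lp.eLpNorm_lt_top X⟩

lemma law_toLp {f : Ω → ℝ} (hf : MemLp f p P) : law (hf.toLp f) = P.map f :=
  Measure.map_congr hf.coeFn_toLp

lemma isBoundedFamily_image_law [IsProbabilityMeasure P] (hq : q ≠ 0) {𝔜 : Set (Lp ℝ q P)} {C : ℝ}
    (hC : ∀ Y ∈ 𝔜, ‖Y‖ ≤ C) : IsBoundedFamily q (law '' 𝔜) := by
  refine ⟨?_, ?_⟩
  · rintro _ ⟨Y, -, rfl⟩
    exact law_mem_finiteMoment hq Y
  · refine lt_of_le_of_lt (b := ENNReal.ofReal C) (iSup₂_le ?_) ENNReal.ofReal_lt_top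
    rintro _ ⟨Y, hY, rfl⟩
    rw [moment_law hq, ← ENNReal.ofReal_toReal (Lp.eLpNorm_ne_top Y), ← Lp.norm_def]
    exact ENNReal.ofReal_le_ofReal (hC Y hY)

lemma isNonnegUnitMean_image_law {𝔜 : Set (Lp ℝ q P)} (h0 : ∀ Y ∈ 𝔜, ∀ᵐ ω ∂P, 0 ≤ Y ω)
    (h1 : ∀ Y ∈ 𝔜, ∫ ω, Y ω ∂P = 1) : IsNonnegUnitMean (law '' 𝔜) := by
  refine ⟨Set.iUnion₂_subset ?_, ?_⟩
  · rintro _ ⟨Y, hY, rfl⟩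
    refine Measure.support_subset_of_isClosed isClosed_Ici ?_
    exact (ae_map_iff (measurable_coe_lp Y).aemeasurable measurableSet_Ici).2 (h0 Y hY)
  · rintro _ ⟨Y, hY, rfl⟩
    rw [law, integral_map (measurable_coe_lp Y).aemeasurable (by fun_prop)]
    exact h1 Y hY

lemma integral_mul_le_transportRisk [IsProbabilityMeasure P] {R : Set (Measure ℝ)} (X : Lp ℝ p P)
    {Y : Lp ℝ q P} (hY : law Y ∈ R) :
    ((∫ ω, X ω * Y ω ∂P : ℝ) : EReal) ≤ transportRisk R X := by
  have hm : Measurable fun ω => (X ω, Y ω) := (measurable_coe_lp X).prodMk (measurable_coe_lp Y)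
  have hmem : P.map (fun ω => (X ω, Y ω)) ∈ plans (law X) R := by
    refine ⟨Measure.isProbabilityMeasure_map hm.aemeasurable, ?_, ?_⟩
    · rw [Measure.map_map measurable_fst hm]; rfl
    · rw [Measure.map_map measurable_snd hm]; exact hY
  have hint : ∫ z, z.1 * z.2 ∂(P.map fun ω => (X ω, Y ω)) = ∫ ω, X ω * Y ω ∂P :=
    integral_map hm.aemeasurable (by fun_prop)
  rw [← hint]
  exact le_iSup₂ (f := fun (π : Measure (ℝ × ℝ)) (_ : π ∈ plans (law X) R) =>
    ((∫ z, z.1 * z.2 ∂π : ℝ) : EReal)) _ hmem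

lemma IsDualSet.le_transportRisk [IsProbabilityMeasure P] {ρ : Lp ℝ p P → ℝ} {𝔜 : Set (Lp ℝ q P)}
    (h : IsDualSet ρ 𝔜) (X : Lp ℝ p P) : (ρ X : EReal) ≤ transportRisk (law '' 𝔜) X := by
  by_contra! hlt
  obtain ⟨r, hr, hrρ⟩ := EReal.lt_iff_exists_real_btwn.1 hlt
  obtain ⟨_, ⟨Y, hY, rfl⟩, hrY⟩ := (lt_isLUB_iff (h.represents X)).1 (EReal.coe_lt_coe_iff.1 hrρ)
  refine absurd (hr.trans (EReal.coe_lt_coe_iff.2 hrY)) (not_lt.2 ?_)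
  exact integral_mul_le_transportRisk X (Set.mem_image_of_mem _ hY)

end Moments

/-! ### Approximating plans by random variables with a given partner -/

section Coupling

lemma map_prodMk_eq_sum {E S ι : Type*} [MeasurableSpace E] [MeasurableSpace S] [Countable ι]
    [MeasurableSpace ι] [MeasurableSingletonClass ι] (M : Measure E) {c : E → ι} {u : E → S}
    (hc : Measurable c) (hu : Measurable u) : M.map (fun ω => (u ω, c ω)) =
      Measure.sum fun k => ((M.restrict (c ⁻¹' {k})).map u).map fun s => (s, k) := by
  have hdec : M = Measure.sum fun k => M.restrict (c ⁻¹' {k}) := by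
    rw [← Measure.restrict_iUnion (fun i j hij => Disjoint.preimage _ (by simpa using hij))
      fun k => hc (measurableSet_singleton k), ← Set.preimage_iUnion, Set.iUnion_of_singleton,
      Set.preimage_univ, Measure.restrict_univ]
  conv_lhs => rw [hdec]
  rw [Measure.map_sum (hu.prodMk hc).aemeasurable]
  congr 1
  ext1 k
  rw [Measure.map_map (by fun_prop) hu]
  refine Measure.map_congr ?_
  filter_upwards [ae_restrict_mem (hc (measurableSet_singleton k))] with ω hω
  rw [Function.comp_apply, show c ω = k from hω]

/-- With a countable second coordinate, the restrictions to fibres play the role of a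
disintegration. -/
lemma map_prodMk_eq_of_restrict_fiber {Ω Ω' S ι : Type*} [MeasurableSpace Ω] [MeasurableSpace Ω']
    [MeasurableSpace S] [Countable ι] [MeasurableSpace ι] [MeasurableSingletonClass ι]
    {P : Measure Ω} {Q : Measure Ω'} {κ : Ω → ι} {κ' : Ω' → ι} {f : Ω → S} {g : Ω' → S}
    (hκ : Measurable κ) (hκ' : Measurable κ') (hf : Measurable f) (hg : Measurable g)
    (h : ∀ k, (P.restrict (κ ⁻¹' {k})).map f = (Q.restrict (κ' ⁻¹' {k})).map g) :
    P.map (fun ω => (f ω, κ ω)) = Q.map (fun ω => (g ω, κ' ω)) := by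
  rw [map_prodMk_eq_sum P hκ hf, map_prodMk_eq_sum Q hκ' hg]
  simp_rw [h]

variable {Ω : Type*} [MeasurableSpace Ω] {P : Measure Ω}

/-- On a nonatomic space, a coupling with the law of a given discrete random variable is the joint
law with some other random variable. -/
theorem Nonatomic.exists_map_prodMk_eq {S ι : Type*} [MeasurableSpace S]
    [StandardBorelSpace S] [Nonempty S] [Countable ι] [MeasurableSpace ι]
    [MeasurableSingletonClass ι] [IsFiniteMeasure P] (h : Nonatomic P) {κ : Ω → ι}
    (hκ : Measurable κ) {π : Measure (S × ι)} (hπ : π.map Prod.snd = P.map κ) :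
    ∃ T : Ω → S, Measurable T ∧ P.map (fun ω => (T ω, κ ω)) = π := by
  obtain ⟨T, hT, hmap⟩ := h.exists_measurable_map_restrict_eq hκ
    (fun k => (π.restrict (Prod.snd ⁻¹' {k})).map Prod.fst) (fun k => by
      rw [Measure.map_apply measurable_fst .univ, Set.preimage_univ, Measure.restrict_apply_univ,
        ← Measure.map_apply measurable_snd (measurableSet_singleton k), hπ,
        Measure.map_apply hκ (measurableSet_singleton k)])
  refine ⟨T, hT, ?_⟩
  rw [map_prodMk_eq_of_restrict_fiber hκ measurable_snd hT measurable_fst hmap]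
  exact Measure.map_id

lemma abs_sub_mul_floor_div_le {ε : ℝ} (hε : 0 < ε) (y : ℝ) : |y - ε * ⌊y / ε⌋| ≤ ε := by
  have h1 := Int.floor_le (y / ε)
  have h2 := Int.lt_floor_add_one (y / ε)
  rw [le_div_iff₀ hε] at h1
  rw [div_lt_iff₀ hε] at h2
  rw [abs_le]
  constructor <;> nlinarith

lemma abs_integral_mul_sub_floor_le {E : Type*} [MeasurableSpace E] {π : Measure E} {f g : E → ℝ}
    (hf : Integrable f π) (hg : Measurable g) (hfg : Integrable (fun z => f z * g z) π)
    {ε : ℝ} (hε : 0 < ε) :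
    |∫ z, f z * g z ∂π - ∫ z, f z * (ε * ⌊g z / ε⌋) ∂π| ≤ ε * ∫ z, |f z| ∂π := by
  have hmeas : Measurable fun z => g z - ε * ⌊g z / ε⌋ := by
    refine hg.sub (Measurable.const_mul ?_ ε)
    exact (measurable_from_top (f := fun n : ℤ => (n : ℝ))).comp
      (Int.measurable_floor.comp (hg.div_const ε))
  have hdiff : Integrable (fun z => f z * (g z - ε * ⌊g z / ε⌋)) π :=
    hf.mul_bdd hmeas.aestronglyMeasurable (ae_of_all _ fun z => abs_sub_mul_floor_div_le hε _)
  -- The product with the rounding is `f * g` minus `f` times a bounded error.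
  have hint : Integrable (fun z => f z * (ε * ⌊g z / ε⌋)) π := by
    refine (hfg.sub hdiff).congr (ae_of_all _ fun z => ?_)
    simp only [Pi.sub_apply]
    ring
  rw [← integral_sub hfg hint, ← integral_const_mul]
  refine (abs_integral_le_integral_abs).trans (integral_mono (hfg.sub hint).abs
    (hf.abs.const_mul ε) fun z => ?_)
  simp only
  rw [← mul_sub, abs_mul, mul_comm]
  gcongr
  exact abs_sub_mul_floor_div_le hε _

variable [IsProbabilityMeasure P] {p q : ℝ≥0∞}

/-- On a nonatomic space, the value of a transport plan is approximated by pairing the given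
`Y` with a random variable of the prescribed law. -/
lemma Nonatomic.exists_law_eq_integral_mul_ge (h : Nonatomic P)
    (hpq : ENNReal.HolderConjugate p q) {X : Lp ℝ p P} {Y : Lp ℝ q P} {π : Measure (ℝ × ℝ)}
    (hπ1 : π.map Prod.fst = law X) (hπ2 : π.map Prod.snd = law Y) {δ : ℝ} (hδ : 0 < δ) :
    ∃ X' : Lp ℝ p P, law X' = law X ∧ ∫ z, z.1 * z.2 ∂π - δ ≤ ∫ ω, X' ω * Y ω ∂P := by
  have hp : p ≠ 0 := ENNReal.HolderConjugate.ne_zero p q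
  have hp1 : 1 ≤ p := ENNReal.HolderConjugate.one_le p q
  have hq : q ≠ 0 := ENNReal.HolderConjugate.ne_zero q p
  have hY := measurable_coe_lp Y
  set M := ∫ x, |x| ∂(law X)
  have hM : 0 ≤ M := integral_nonneg fun x => abs_nonneg x
  -- Rounding is paid twice, under `P` and under `π`, each time at most `ε * M`; the `M + 1` in the
  -- witness covers `M = 0`.
  obtain ⟨ε, hε, hεM⟩ : ∃ ε : ℝ, 0 < ε ∧ 2 * (ε * M) ≤ δ := by
    refine ⟨δ / (2 * (M + 1)), by positivity, ?_⟩
    rw [← mul_div_right_comm, ← mul_div_assoc, div_le_iff₀ (by positivity)]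
    nlinarith
  have hfl : Measurable fun y : ℝ => ⌊y / ε⌋ := Int.measurable_floor.comp (by fun_prop)
  have hpair : Measurable fun z : ℝ × ℝ => (z.1, ⌊z.2 / ε⌋) :=
    measurable_fst.prodMk (hfl.comp measurable_snd)
  obtain ⟨T, hT, hmap⟩ := h.exists_map_prodMk_eq (hfl.comp hY)
    (π := π.map fun z : ℝ × ℝ => (z.1, ⌊z.2 / ε⌋)) (by
      rw [Measure.map_map measurable_snd hpair, ← Measure.map_map hfl hY]
      change π.map ((fun y : ℝ => ⌊y / ε⌋) ∘ Prod.snd) = (law Y).map _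
      rw [← hπ2, Measure.map_map hfl measurable_snd])
  have hTlaw : P.map T = law X := by
    have := congrArg (Measure.map Prod.fst) hmap
    rw [Measure.map_map measurable_fst (hT.prodMk (hfl.comp hY)),
      Measure.map_map measurable_fst hpair] at this
    exact this.trans hπ1
  have hTmem : MemLp T p P :=
    memLp_of_map_mem_finiteMoment hp hT (hTlaw ▸ law_mem_finiteMoment hp X)
  have hmem1 : MemLp Prod.fst p π :=
    memLp_of_map_mem_finiteMoment hp measurable_fst (hπ1 ▸ law_mem_finiteMoment hp X)
  have hmem2 : MemLp Prod.snd q π :=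
    memLp_of_map_mem_finiteMoment hq measurable_snd (hπ2 ▸ law_mem_finiteMoment hq Y)
  have : IsProbabilityMeasure (π.map Prod.fst) := hπ1 ▸ (law_mem_finiteMoment hp X).1
  have : IsProbabilityMeasure π := Measure.isProbabilityMeasure_of_map Prod.fst
  refine ⟨hTmem.toLp T, (law_toLp hTmem).trans hTlaw, ?_⟩
  have hcongr : ∫ ω, hTmem.toLp T ω * Y ω ∂P = ∫ ω, T ω * Y ω ∂P :=
    integral_congr_ae (hTmem.coeFn_toLp.mul (ae_eq_refl _))
  have h1 := abs_integral_mul_sub_floor_le (hTmem.integrable hp1) hY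
    (hTmem.integrable_mul (Lp.memLp Y)) hε
  have h2 := abs_integral_mul_sub_floor_le (hmem1.integrable hp1) measurable_snd
    (hmem1.integrable_mul hmem2) hε
  have hM1 : ∫ ω, |T ω| ∂P = M := by
    rw [← integral_map (f := fun x : ℝ => |x|) hT.aemeasurable (by fun_prop), hTlaw]
  have hM2 : ∫ z, |z.1| ∂π = M := by
    rw [← integral_map (f := fun x : ℝ => |x|) measurable_fst.aemeasurable (by fun_prop), hπ1]
  have hphi : Measurable fun z : ℝ × ℤ => z.1 * (ε * (z.2 : ℝ)) :=
    measurable_fst.mul (((measurable_from_top (f := fun n : ℤ => (n : ℝ))).comp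
      measurable_snd).const_mul ε)
  -- Both sides integrate one function on `ℝ × ℤ` against the same joint law.
  have heq : ∫ ω, T ω * (ε * ⌊Y ω / ε⌋) ∂P = ∫ z, z.1 * (ε * ⌊z.2 / ε⌋) ∂π := by
    have e1 := integral_map (μ := P) (hT.prodMk (hfl.comp hY)).aemeasurable
      hphi.aestronglyMeasurable
    have e2 := integral_map (μ := π) hpair.aemeasurable hphi.aestronglyMeasurable
    exact e1.symm.trans ((congrArg (fun μ => ∫ z, z.1 * (ε * (z.2 : ℝ)) ∂μ) hmap).trans e2)
  rw [hcongr]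
  rw [hM1, heq] at h1
  rw [hM2] at h2
  have h1' := abs_le.1 h1
  have h2' := abs_le.1 h2
  linarith [h1'.1, h2'.2]

lemma IsDualSet.iSup_eq_transportRisk (hpq : ENNReal.HolderConjugate p q) {ρ : Lp ℝ p P → ℝ}
    {𝔜 : Set (Lp ℝ q P)} (h : IsDualSet ρ 𝔜) (hP : Nonatomic P) (X : Lp ℝ p P) :
    ⨆ X' ∈ {X' : Lp ℝ p P | law X' = law X}, (ρ X' : EReal) = transportRisk (law '' 𝔜) X := by
  apply le_antisymm
  · refine iSup₂_le fun X' hX' => ?_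
    rw [transportRisk, ← show law X' = law X from hX']
    exact h.le_transportRisk X'
  · refine iSup₂_le ?_
    rintro π ⟨-, hπ1, Y, hY, hπ2⟩
    refine EReal.le_of_forall_lt_iff_le.1 fun r hr => ?_
    by_contra! hlt
    rw [EReal.coe_lt_coe_iff] at hlt
    -- With the whole gap above `r` as tolerance, the pairing of `X'` with `Y` is still at least
    -- `r`.
    obtain ⟨X', hX', hge⟩ := hP.exists_law_eq_integral_mul_ge hpq hπ1 hπ2.symm
      (sub_pos.2 hlt)
    have h1 : r ≤ ρ X' := by
      have := (h.represents X').1 (Set.mem_image_of_mem _ hY)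
      linarith
    have h2 : (ρ X' : EReal) < r := lt_of_le_of_lt
      (le_iSup₂ (f := fun (X' : Lp ℝ p P) (_ : X' ∈ {X' : Lp ℝ p P | law X' = law X}) =>
        (ρ X' : EReal)) X' hX') hr
    exact absurd (EReal.coe_lt_coe_iff.1 h2) (not_lt.2 h1)

lemma IsDualSet.eq_transportRisk (hpq : ENNReal.HolderConjugate p q) {ρ : Lp ℝ p P → ℝ}
    {𝔜 : Set (Lp ℝ q P)} (h : IsDualSet ρ 𝔜) (hP : Nonatomic P) (hρ : IsLawInvariant ρ)
    (X : Lp ℝ p P) : (ρ X : EReal) = transportRisk (law '' 𝔜) X := by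
  refine le_antisymm (h.le_transportRisk X) ?_
  rw [← h.iSup_eq_transportRisk hpq hP X]
  refine iSup₂_le fun X' hX' => ?_
  rw [hρ X' X hX']

end Coupling

/-! ### Sublinearity, supporting functionals and automatic boundedness -/

section CoherentBasics

variable {Ω : Type*} [MeasurableSpace Ω] {P : Measure Ω} [IsProbabilityMeasure P] {p : ℝ≥0∞}
  {ρ : Lp ℝ p P → ℝ}

lemma IsCoherent.map_zero (hρ : IsCoherent ρ) : ρ 0 = 0 := by
  simpa using hρ.homogeneous 0 0 le_rfl

lemma IsCoherent.add_le (hρ : IsCoherent ρ) (X Y : Lp ℝ p P) : ρ (X + Y) ≤ ρ X + ρ Y := by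
  have h1 := hρ.convex X Y (1 / 2) ⟨by norm_num, by norm_num⟩
  have h2 := hρ.homogeneous ((1 - 1 / 2 : ℝ) • X + (1 / 2 : ℝ) • Y) 2 (by norm_num)
  have h3 : (2 : ℝ) • ((1 - 1 / 2 : ℝ) • X + (1 / 2 : ℝ) • Y) = X + Y := by
    rw [smul_add, smul_smul, smul_smul]; norm_num
  rw [h3] at h2
  linarith

lemma IsCoherent.average_le (hρ : IsCoherent ρ) {X : ℕ → Lp ℝ p P} {c : ℝ} (hX : ∀ n, ρ (X n) ≤ c)
    {n : ℕ} (hn : n ≠ 0) : ρ ((n : ℝ)⁻¹ • ∑ i ∈ Finset.range n, X i) ≤ c := by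
  rw [hρ.homogeneous _ _ (by positivity), inv_mul_le_iff₀ (by positivity)]
  refine (Finset.le_sum_of_subadditive ρ hρ.map_zero.le hρ.add_le _ _).trans ?_
  simpa using Finset.sum_le_card_nsmul (Finset.range n) _ c fun i _ => hX i

/-- Hahn–Banach applied to `c • X ↦ c * ρ X`. For `c ≤ 0` domination by `ρ` follows from `0 = ρ 0 ≤
ρ (c • X) + ρ (-c • X)`. -/
lemma IsCoherent.exists_linear_le (hρ : IsCoherent ρ) (X : Lp ℝ p P) :
    ∃ f : Lp ℝ p P →ₗ[ℝ] ℝ, f X = ρ X ∧ ∀ Z, f Z ≤ ρ Z := by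
  have H : ∀ c : ℝ, c • X = 0 → c • ρ X = 0 := by
    intro c hc
    rcases smul_eq_zero.1 hc with rfl | rfl
    · simp
    · simp [hρ.map_zero]
  obtain ⟨f, hf, hle⟩ := exists_extension_of_le_sublinear
    (LinearPMap.mkSpanSingleton' X (ρ X) H) ρ (fun c hc x => hρ.homogeneous x c hc.le) hρ.add_le (by
      rintro ⟨x, hx⟩
      obtain ⟨c, rfl⟩ := Submodule.mem_span_singleton.1 hx
      rw [LinearPMap.mkSpanSingleton'_apply]
      simp only [RingHom.id_apply, smul_eq_mul]
      rcases le_total 0 c with hc | hc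
      · rw [hρ.homogeneous X c hc]
      · have h1 := hρ.homogeneous X (-c) (neg_nonneg.2 hc)
        have h2 := hρ.add_le (c • X) ((-c) • X)
        rw [← add_smul, add_neg_cancel, zero_smul, hρ.map_zero, h1] at h2
        linarith)
  refine ⟨f, ?_, hle⟩
  exact (hf ⟨X, Submodule.mem_span_singleton_self X⟩).trans
    (LinearPMap.mkSpanSingleton'_apply_self X (ρ X) H _)

/-- A coherent risk measure on `L^p` is bounded above on the unit ball. -/
lemma IsCoherent.exists_le_mul_norm [Fact (1 ≤ p)] (hρ : IsCoherent ρ) :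
    ∃ C : ℝ, 0 ≤ C ∧ ∀ X, ρ X ≤ C * ‖X‖ := by
  by_contra! hC
  choose X hX using fun n : ℕ => hC (4 ^ n) (by positivity)
  have hnorm : ∀ n, 0 < ‖X n‖ := by
    intro n
    refine norm_pos_iff.2 fun h0 => ?_
    have := hX n
    rw [h0, hρ.map_zero] at this
    simp at this
  have hmono : ∀ Y Z : Lp ℝ p P, Y ≤ Z → ρ Y ≤ ρ Z := fun Y Z hYZ =>
    hρ.monotone Y Z (Lp.coeFn_le Y Z |>.2 hYZ)
  -- The rescaling gives `Z n` norm `2⁻ⁿ` while `ρ (Z n) ≥ 2ⁿ`. The nonnegative series converges and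
  -- its sum dominates every term, so by monotonicity `ρ` would be infinite there.
  let Z : ℕ → Lp ℝ p P := fun n => ((1 / 2 : ℝ) ^ n * ‖X n‖⁻¹) • |X n|
  have hZnorm : ∀ n, ‖Z n‖ = (1 / 2 : ℝ) ^ n := by
    intro n
    rw [norm_smul, norm_abs_eq_norm, Real.norm_of_nonneg (by positivity), mul_assoc,
      inv_mul_cancel₀ (hnorm n).ne', mul_one]
  have hZ0 : ∀ n, 0 ≤ Z n := by
    intro n
    rw [← Lp.coeFn_nonneg]
    filter_upwards [Lp.coeFn_smul ((1 / 2 : ℝ) ^ n * ‖X n‖⁻¹) |X n|, Lp.coeFn_abs (X n)] with ω h1 h2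
    rw [h1, Pi.smul_apply, h2]
    simp only [Pi.zero_apply, smul_eq_mul]
    positivity
  have hsum : Summable Z := by
    refine Summable.of_norm ?_
    simp_rw [hZnorm]
    exact summable_geometric_of_lt_one (by norm_num) (by norm_num)
  have hlarge : ∀ n, (2 : ℝ) ^ n ≤ ρ (∑' n, Z n) := by
    intro n
    calc (2 : ℝ) ^ n = (1 / 2 : ℝ) ^ n * ‖X n‖⁻¹ * (4 ^ n * ‖X n‖) := by
          rw [show (4 : ℝ) ^ n = 2 ^ n * 2 ^ n by rw [← mul_pow]; norm_num, one_div, inv_pow]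
          have := (hnorm n).ne'
          field_simp
      _ ≤ (1 / 2 : ℝ) ^ n * ‖X n‖⁻¹ * ρ |X n| := by
          gcongr
          exact (hX n).le.trans (hmono _ _ (le_abs_self _))
      _ = ρ (Z n) := (hρ.homogeneous _ _ (by positivity)).symm
      _ ≤ ρ (∑' n, Z n) := hmono _ _ (hsum.le_tsum n fun m _ => hZ0 m)
  obtain ⟨n, hn⟩ := pow_unbounded_of_one_lt (ρ (∑' n, Z n)) one_lt_two
  exact absurd (hlarge n) (not_le.2 hn)

end CoherentBasics

/-! ### Sums and norms in `L^p` -/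

section LpAuxiliary

variable {Ω : Type*} [MeasurableSpace Ω] {P : Measure Ω} {p : ℝ≥0∞}

lemma toLp_sum_range {f : ℕ → Ω → ℝ} (hf : ∀ n, MemLp (f n) p P) (n : ℕ)
    (h : MemLp (∑ i ∈ Finset.range n, f i) p P) :
    h.toLp _ = ∑ i ∈ Finset.range n, (hf i).toLp (f i) := by
  induction n with
  | zero => simp
  | succ n ih =>
    have hn : MemLp (∑ i ∈ Finset.range n, f i) p P := memLp_finsetSum' _ fun i _ => hf i
    rw [Finset.sum_range_succ (fun i => (hf i).toLp (f i)), ← ih hn, ← MemLp.toLp_add]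
    exact MemLp.toLp_congr _ _ (by rw [Finset.sum_range_succ])

lemma norm_eq_of_law_eq [Fact (1 ≤ p)] {X Y : Lp ℝ p P} (h : law X = law Y) : ‖X‖ = ‖Y‖ := by
  have hp : p ≠ 0 := (zero_lt_one.trans_le (Fact.out : 1 ≤ p)).ne'
  rw [Lp.norm_def, Lp.norm_def, ← moment_law hp, ← moment_law hp, h]

end LpAuxiliary

/-! ### Monotonicity under conditional expectation -/

section Dilatation

variable {Ω : Type*} [MeasurableSpace Ω] {P : Measure Ω} [IsProbabilityMeasure P]

lemma ae_tendsto_average_infinitePi {ν : Measure ℝ} [IsProbabilityMeasure ν]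
    (hν : Integrable (fun x => x) ν) :
    ∀ᵐ x : ℕ → ℝ ∂(Measure.infinitePi fun _ : ℕ => ν),
      Tendsto (fun n : ℕ => (∑ i ∈ Finset.range n, x i) / n) atTop (𝓝 (∫ y : ℝ, y ∂ν)) := by
  have hmap : ∀ i, (Measure.infinitePi fun _ : ℕ => ν).map (fun x => x i) = ν := fun i =>
    Measure.infinitePi_map_eval _ i
  have hind := ProbabilityTheory.iIndepFun_infinitePi (P := fun _ : ℕ => ν) (X := fun _ x => x)
    (fun _ => measurable_id)
  have hint : Integrable (fun x : ℕ → ℝ => x 0) (Measure.infinitePi fun _ : ℕ => ν) := by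
    have h0 := hmap 0
    rw [← h0] at hν
    exact hν.comp_measurable (measurable_pi_apply 0)
  have h := ProbabilityTheory.strong_law_ae_real (fun (i : ℕ) (x : ℕ → ℝ) => x i) hint
    (fun i j hij => hind.indepFun hij) (fun i =>
      ⟨(measurable_pi_apply i).aemeasurable, (measurable_pi_apply 0).aemeasurable,
        (hmap i).trans (hmap 0).symm⟩)
  have hlim : ∫ x, x 0 ∂(Measure.infinitePi fun _ : ℕ => ν) = ∫ y, y ∂ν := by
    conv_rhs => rw [← hmap 0]
    exact (integral_map (φ := fun x : ℕ → ℝ => x 0) (f := fun y : ℝ => y)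
      (measurable_pi_apply 0).aemeasurable
      (by fun_prop)).symm
  rwa [hlim] at h

/-- On a nonatomic space, the conditional expectation with respect to a discrete random variable is
an almost sure limit of averages of copies of the given random variable. -/
lemma Nonatomic.exists_copies_tendsto_average (h : Nonatomic P) {ι : Type*} [Countable ι]
    [MeasurableSpace ι] [MeasurableSingletonClass ι] {κ : Ω → ι} (hκ : Measurable κ) {Z : Ω → ℝ}
    (hZ : Measurable Z) (hint : Integrable Z P) :
    ∃ T : ℕ → Ω → ℝ, (∀ n, Measurable (T n)) ∧ (∀ n, P.map (T n) = P.map Z) ∧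
      ∀ᵐ ω ∂P, Tendsto (fun n : ℕ => (∑ i ∈ Finset.range n, T i ω) / n) atTop
        (𝓝 (⨍ x in κ ⁻¹' {κ ω}, Z x ∂P)) := by
  classical
  have hk : ∀ k, MeasurableSet (κ ⁻¹' {k}) := fun k => hκ (measurableSet_singleton k)
  -- Conditional law of `Z` on each fibre; the Dirac mass on null fibres only keeps every `ν k` a
  -- probability measure, as the infinite product requires.
  let ν : ι → Measure ℝ := fun k => if P (κ ⁻¹' {k}) = 0 then Measure.dirac 0
    else ((P (κ ⁻¹' {k}))⁻¹ • P.restrict (κ ⁻¹' {k})).map Z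
  have hν : ∀ k, IsProbabilityMeasure (ν k) := by
    intro k
    by_cases h0 : P (κ ⁻¹' {k}) = 0
    · simp only [ν, h0, if_true]; infer_instance
    · simp only [ν, h0, if_false]
      have : IsProbabilityMeasure ((P (κ ⁻¹' {k}))⁻¹ • P.restrict (κ ⁻¹' {k})) :=
        ⟨by simp [ENNReal.inv_mul_cancel h0 (measure_ne_top _ _)]⟩
      exact Measure.isProbabilityMeasure_map hZ.aemeasurable
  have hνmul : ∀ k, P (κ ⁻¹' {k}) • ν k = (P.restrict (κ ⁻¹' {k})).map Z := by
    intro k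
    by_cases h0 : P (κ ⁻¹' {k}) = 0
    · simp [h0, Measure.restrict_eq_zero.2 h0]
    · simp only [ν, h0, if_false]
      rw [Measure.map_smul, smul_smul, ENNReal.mul_inv_cancel h0 (measure_ne_top _ _), one_smul]
  -- On each fibre of positive mass the coordinates of `T` are i.i.d. with the conditional law of
  -- `Z`, so the strong law applies fibre by fibre.
  obtain ⟨T, hT, hmap⟩ := h.exists_measurable_map_restrict_eq hκ
    (fun k => P (κ ⁻¹' {k}) • Measure.infinitePi fun _ : ℕ => ν k) (fun k => by simp)
  have hTn : ∀ n, Measurable fun ω => T ω n := fun n => (measurable_pi_apply n).comp hT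
  refine ⟨fun n ω => T ω n, hTn, fun n => ?_, ?_⟩
  · have hfib : ∀ k, (P.restrict (κ ⁻¹' {k})).map (fun ω => T ω n)
        = (P.restrict (κ ⁻¹' {k})).map Z := by
      intro k
      have : (P.restrict (κ ⁻¹' {k})).map (fun ω => T ω n)
          = ((P.restrict (κ ⁻¹' {k})).map T).map (fun x => x n) :=
        (Measure.map_map (measurable_pi_apply n) hT).symm
      rw [this, hmap, Measure.map_smul, Measure.infinitePi_map_eval, hνmul]
    have := congrArg (Measure.map Prod.fst) (map_prodMk_eq_of_restrict_fiber hκ hκ (hTn n) hZ hfib)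
    rwa [Measure.map_map measurable_fst ((hTn n).prodMk hκ),
      Measure.map_map measurable_fst (hZ.prodMk hκ)] at this
  · have hfib : ∀ k, ∀ᵐ ω ∂P, κ ω = k → Tendsto (fun n : ℕ => (∑ i ∈ Finset.range n, T ω i) / n)
        atTop (𝓝 (⨍ x in κ ⁻¹' {k}, Z x ∂P)) := by
      intro k
      by_cases h0 : P (κ ⁻¹' {k}) = 0
      · have : ∀ᵐ ω ∂P, ω ∉ κ ⁻¹' {k} := measure_eq_zero_iff_ae_notMem.1 h0
        filter_upwards [this] with ω hω hωk
        exact absurd hωk hω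
      · have hνk : ν k = ((P (κ ⁻¹' {k}))⁻¹ • P.restrict (κ ⁻¹' {k})).map Z := by
          simp only [ν, h0, if_false]
        have hlim : ∫ y, y ∂(ν k) = ⨍ x in κ ⁻¹' {k}, Z x ∂P := by
          rw [hνk, integral_map hZ.aemeasurable (by fun_prop), setAverage_eq']
        have hintk : Integrable (fun x => x) (ν k) := by
          rw [hνk, integrable_map_measure (by fun_prop) hZ.aemeasurable]
          exact hint.restrict.smul_measure (ENNReal.inv_ne_top.2 h0)
        have hae := Measure.ae_smul_measure (ae_tendsto_average_infinitePi hintk) (P (κ ⁻¹' {k}))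
        rw [← hmap k, hlim] at hae
        exact (ae_restrict_iff' (hk k)).1 (ae_of_ae_map hT.aemeasurable hae)
    filter_upwards [ae_all_iff.2 hfib] with ω hω
    exact hω _ rfl

variable {p : ℝ≥0∞} [Fact (1 ≤ p)] {ρ : Lp ℝ p P → ℝ}

/-- A coherent law-invariant risk measure on a nonatomic space decreases under conditional
expectations with respect to discrete random variables. -/
theorem IsCoherent.apply_setAverage_le (hρ : IsCoherent ρ) (hinv : IsLawInvariant ρ)
    (hfatou : p = ∞ → HasFatouProperty ρ) (hP : Nonatomic P) {ι : Type*} [Countable ι]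
    [MeasurableSpace ι] [MeasurableSingletonClass ι] {κ : Ω → ι} (hκ : Measurable κ)
    (Z : Lp ℝ p P) (hW : MemLp (fun ω => ⨍ x in κ ⁻¹' {κ ω}, Z x ∂P) p P) :
    ρ (hW.toLp _) ≤ ρ Z := by
  have hp1 : 1 ≤ p := Fact.out
  have hp0 : p ≠ 0 := (zero_lt_one.trans_le hp1).ne'
  obtain ⟨T, hT, hlaw, hlim⟩ := hP.exists_copies_tendsto_average hκ (measurable_coe_lp Z)
    ((Lp.memLp Z).integrable hp1)
  have hTmem : ∀ n, MemLp (T n) p P := fun n =>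
    memLp_of_map_mem_finiteMoment hp0 (hT n) (hlaw n ▸ law_mem_finiteMoment hp0 Z)
  let f : ℕ → Ω → ℝ := fun n => (n : ℝ)⁻¹ • ∑ i ∈ Finset.range n, T i
  have hsummem : ∀ n : ℕ, MemLp (∑ i ∈ Finset.range n, T i) p P := fun n =>
    memLp_finsetSum' _ fun i _ => hTmem i
  have hfmem : ∀ n, MemLp (f n) p P := fun n => (hsummem n).const_smul _
  have hflim : ∀ᵐ ω ∂P, Tendsto (fun n => f n ω) atTop (𝓝 (⨍ x in κ ⁻¹' {κ ω}, Z x ∂P)) := by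
    filter_upwards [hlim] with ω hω
    refine hω.congr fun n => ?_
    simp [f, div_eq_inv_mul]
  have hlawT : ∀ n, law ((hTmem n).toLp (T n)) = law Z := fun n =>
    (law_toLp (hTmem n)).trans (hlaw n)
  have htoLp : ∀ n, (hfmem n).toLp (f n) =
      (n : ℝ)⁻¹ • ∑ i ∈ Finset.range n, (hTmem i).toLp (T i) := fun n => by
    rw [← toLp_sum_range hTmem n (hsummem n)]
    exact MemLp.toLp_const_smul _ (hsummem n)
  have hle : ∀ᶠ n in atTop, ρ ((hfmem n).toLp (f n)) ≤ ρ Z := by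
    filter_upwards [eventually_ne_atTop 0] with n hn
    rw [htoLp]
    exact hρ.average_le (fun i => (hinv _ _ (hlawT i)).le) hn
  by_cases hp : p = ∞
  -- For `p = ∞`, the averages stay in the ball of radius `‖Z‖`, so the Fatou property applies.
  · have hbound : ∀ n, ‖(hfmem n).toLp (f n)‖ ≤ ‖Z‖ := by
      intro n
      rw [htoLp, norm_smul, norm_inv, Real.norm_natCast]
      rcases eq_or_ne n 0 with rfl | hn
      · simp
      rw [inv_mul_le_iff₀ (by positivity)]
      refine (norm_sum_le _ _).trans ?_
      simpa using Finset.sum_le_card_nsmul (Finset.range n) _ ‖Z‖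
        fun i _ => (norm_eq_of_law_eq (hlawT i)).le
    have hmeas : TendstoInMeasure P (fun n => ((hfmem n).toLp (f n) : Ω → ℝ)) atTop
        (hW.toLp _ : Ω → ℝ) := by
      refine (tendstoInMeasure_of_tendsto_ae (fun n => (hfmem n).1) hflim).congr
        (fun n => (hfmem n).coeFn_toLp.symm) hW.coeFn_toLp.symm
    have hF := hfatou hp _ _ ⟨‖Z‖, hbound⟩ hmeas
    rw [← EReal.coe_le_coe_iff]
    refine hF.trans (liminf_le_of_frequently_le' (Eventually.frequently ?_))
    filter_upwards [hle] with n hn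
    exact EReal.coe_le_coe_iff.2 hn
  -- For `p < ∞`, averages of identically distributed variables are uniformly integrable; Vitali's
  -- theorem upgrades the limit to norm convergence, and subadditivity with the bound `C` passes `ρ`
  -- to the limit.
  · obtain ⟨C, hC0, hC⟩ := hρ.exists_le_mul_norm
    have hui : UnifIntegrable f p P := (uniformIntegrable_average hp1
      (ProbabilityTheory.MemLp.uniformIntegrable_of_identDistrib (j := 0) hp1 hp (hTmem 0)
        fun i => ⟨(hT i).aemeasurable, (hT 0).aemeasurable,
          (hlaw i).trans (hlaw 0).symm⟩)).unifIntegrable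
    have hnorm := tendsto_Lp_finite_of_tendsto_ae hp1 hp (fun n => (hfmem n).1) hW hui hflim
    have hnorm' : Tendsto (fun n => (hfmem n).toLp (f n)) atTop (𝓝 (hW.toLp _)) :=
      (Lp.tendsto_Lp_iff_tendsto_eLpNorm'' f hfmem _ hW).2 hnorm
    have hdist : Tendsto (fun n => ρ Z + C * ‖hW.toLp _ - (hfmem n).toLp (f n)‖) atTop
        (𝓝 (ρ Z + C * 0)) := by
      refine Tendsto.const_add _ (Tendsto.const_mul _ ?_)
      have := (tendsto_const_nhds (x := hW.toLp _)).sub hnorm'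
      rw [sub_self] at this
      simpa using this.norm
    rw [mul_zero, add_zero] at hdist
    refine ge_of_tendsto hdist ?_
    filter_upwards [hle] with n hn
    calc ρ (hW.toLp _) = ρ ((hfmem n).toLp (f n) + (hW.toLp _ - (hfmem n).toLp (f n))) := by
          rw [add_sub_cancel]
      _ ≤ ρ ((hfmem n).toLp (f n)) + ρ (hW.toLp _ - (hfmem n).toLp (f n)) := hρ.add_le _ _
      _ ≤ _ := add_le_add hn (hC _)

end Dilatation

/-! ### Positivity, normalization and boundedness of dominated densities -/

section DualNorm

variable {Ω : Type*} [MeasurableSpace Ω] {P : Measure Ω} {p q : ℝ≥0∞}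

/-- The densities of the linear functionals on `L^p` which are dominated by `ρ`. -/
def dualSet (q : ℝ≥0∞) (ρ : Lp ℝ p P → ℝ) : Set (Lp ℝ q P) :=
  {Y | ∀ Z : Lp ℝ p P, ∫ ω, Z ω * Y ω ∂P ≤ ρ Z}

variable {ρ : Lp ℝ p P → ℝ} {Y : Lp ℝ q P}

lemma integral_toLp_mul {f : Ω → ℝ} (hf : MemLp f p P) (g : Ω → ℝ) :
    ∫ ω, hf.toLp f ω * g ω ∂P = ∫ ω, f ω * g ω ∂P :=
  integral_congr_ae (hf.coeFn_toLp.mul (ae_eq_refl _))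

/-- Equality case of Hölder: with `s = q.toReal`, the test function `|Y|^(s-1)` pairs with `Y` to
`‖Y‖^s` and has norm `‖Y‖^(s-1)`, because `p * (s - 1) = q`. -/
lemma norm_le_of_forall_integral_mul_le_of_ne_top (hpq : ENNReal.HolderConjugate p q) (hp : p ≠ ∞)
    (hq : q ≠ ∞) {C : ℝ} (hC0 : 0 ≤ C)
    (hY : ∀ Z : Lp ℝ p P, ∫ ω, Z ω * Y ω ∂P ≤ C * ‖Z‖) (h0 : ∀ᵐ ω ∂P, 0 ≤ Y ω) : ‖Y‖ ≤ C := by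
  have hpq' : p.toReal.HolderConjugate q.toReal := ENNReal.HolderConjugate.toReal_of_ne_top hp hq
  set s := q.toReal with hs
  have hs1 : 1 < s := hpq'.symm.lt
  have hexp : p * ENNReal.ofReal (s - 1) = q := by
    rw [← ENNReal.ofReal_toReal hp, ← ENNReal.ofReal_mul ENNReal.toReal_nonneg,
      ← ENNReal.ofReal_toReal hq, ← hs, mul_comm, hpq'.symm.sub_one_mul_conj]
  have hnorm : eLpNorm (fun ω => ‖Y ω‖ ^ (s - 1)) p P = eLpNorm Y q P ^ (s - 1) := by
    rw [eLpNorm_norm_rpow _ (sub_pos.2 hs1), hexp]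
  have hmem : MemLp (fun ω => ‖Y ω‖ ^ (s - 1)) p P := by
    refine ⟨((measurable_coe_lp Y).norm.pow_const _).aestronglyMeasurable, ?_⟩
    rw [hnorm]
    exact ENNReal.rpow_lt_top_of_nonneg (sub_pos.2 hs1).le (Lp.eLpNorm_ne_top Y)
  have h1 := hY (hmem.toLp _)
  rw [integral_toLp_mul, Lp.norm_toLp, hnorm, ← ENNReal.toReal_rpow, ← Lp.norm_def] at h1
  have h2 : ∫ ω, ‖Y ω‖ ^ (s - 1) * Y ω ∂P = ‖Y‖ ^ s := by
    have hq0 : q ≠ 0 := ENNReal.HolderConjugate.ne_zero q p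
    have h3 : ∫ ω, ‖Y ω‖ ^ (s - 1) * Y ω ∂P = ∫ ω, ‖Y ω‖ ^ s ∂P := by
      refine integral_congr_ae ?_
      filter_upwards [h0] with ω hω
      rw [Real.norm_of_nonneg hω]
      rcases hω.eq_or_lt with h | h
      · rw [← h, mul_zero, Real.zero_rpow (by linarith)]
      · rw [← Real.rpow_add_one h.ne', sub_add_cancel]
    rw [h3, Lp.norm_def, (Lp.memLp Y).eLpNorm_eq_integral_rpow_norm hq0 hq, ← hs,
      ENNReal.toReal_ofReal (by positivity), ← Real.rpow_mul (by positivity),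
      inv_mul_cancel₀ (by linarith), Real.rpow_one]
  rw [h2] at h1
  have hnonneg : 0 ≤ ‖Y‖ := Lp.norm_def Y ▸ ENNReal.toReal_nonneg
  rcases hnonneg.eq_or_lt with h | h
  · rwa [← h]
  · have h3 : ‖Y‖ ^ s = ‖Y‖ * ‖Y‖ ^ (s - 1) := by
      rw [mul_comm, ← Real.rpow_add_one h.ne', sub_add_cancel]
    rw [h3] at h1
    exact le_of_mul_le_mul_right h1 (Real.rpow_pos_of_pos h _)

variable [IsProbabilityMeasure P]

lemma integral_indicatorConstLp_mul {A : Set Ω} (hA : MeasurableSet A) (c : ℝ) (g : Ω → ℝ) :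
    ∫ ω, indicatorConstLp p hA (measure_ne_top P A) c ω * g ω ∂P = c * ∫ ω in A, g ω ∂P := by
  rw [← integral_const_mul, ← integral_indicator hA]
  refine integral_congr_ae ?_
  filter_upwards [indicatorConstLp_coeFn (p := p) (hs := hA) (hμs := measure_ne_top P A) (c := c)]
    with ω hω
  rw [hω]
  by_cases h : ω ∈ A <;> simp [h]

lemma IsCoherent.apply_const (hρ : IsCoherent ρ) (c : ℝ) : ρ (Lp.const p P c) = c := by
  have := hρ.translation 0 c
  rwa [zero_add, hρ.map_zero, zero_add] at this

lemma IsCoherent.integral_eq_one_of_mem_dualSet (hρ : IsCoherent ρ) (hY : Y ∈ dualSet q ρ) :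
    ∫ ω, Y ω ∂P = 1 := by
  have hc : ∀ c : ℝ, c * ∫ ω, Y ω ∂P ≤ c := by
    intro c
    have h1 := hY (Lp.const p P c)
    rw [hρ.apply_const] at h1
    refine le_of_eq_of_le ?_ h1
    rw [← integral_const_mul]
    refine integral_congr_ae ?_
    filter_upwards [Lp.coeFn_const (p := p) (μ := P) (c := c)] with ω hω
    rw [hω, Function.const_apply]
  linarith [hc 1, hc (-1)]

/-- Test against minus the indicators, which lie below `0`, and use monotonicity. -/
lemma IsCoherent.ae_nonneg_of_mem_dualSet (hρ : IsCoherent ρ) (hq : 1 ≤ q)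
    (hY : Y ∈ dualSet q ρ) : ∀ᵐ ω ∂P, 0 ≤ Y ω := by
  refine ae_nonneg_of_forall_setIntegral_nonneg ((Lp.memLp Y).integrable hq) fun A hA _ => ?_
  have h1 := hY (indicatorConstLp p hA (measure_ne_top P A) (-1))
  rw [integral_indicatorConstLp_mul] at h1
  have h2 : ρ (indicatorConstLp p hA (measure_ne_top P A) (-1)) ≤ ρ 0 := by
    refine hρ.monotone _ _ ?_
    filter_upwards [indicatorConstLp_coeFn (p := p) (hs := hA) (hμs := measure_ne_top P A)
      (c := (-1 : ℝ)), Lp.coeFn_zero ℝ p P] with ω h1 h2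
    rw [h1, h2]
    by_cases h : ω ∈ A <;> simp [h]
  rw [hρ.map_zero] at h2
  linarith

lemma norm_le_of_forall_integral_mul_le_of_eq_one [Fact (1 ≤ p)] (hp : p = 1) (hq : q = ∞) {C : ℝ}
    (hC0 : 0 ≤ C) (hY : ∀ Z : Lp ℝ p P, ∫ ω, Z ω * Y ω ∂P ≤ C * ‖Z‖)
    (h0 : ∀ᵐ ω ∂P, 0 ≤ Y ω) : ‖Y‖ ≤ C := by
  subst hp hq
  have hle : ∀ᵐ ω ∂P, Y ω ≤ C := by
    refine ae_le_of_forall_setIntegral_le ((Lp.memLp Y).integrable le_top)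
      (integrable_const C) fun A hA _ => ?_
    have h1 := hY (indicatorConstLp 1 hA (measure_ne_top P A) 1)
    rw [integral_indicatorConstLp_mul, one_mul, norm_indicatorConstLp one_ne_zero (by simp)] at h1
    simpa [mul_comm] using h1
  rw [Lp.norm_def]
  refine ENNReal.toReal_le_of_le_ofReal hC0 ?_
  rw [eLpNorm_exponent_top]
  refine eLpNormEssSup_le_of_ae_bound ?_
  filter_upwards [hle, h0] with ω h1 h2
  rwa [Real.norm_of_nonneg h2]

lemma IsCoherent.exists_norm_le_of_mem_dualSet [Fact (1 ≤ p)]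
    (hpq : ENNReal.HolderConjugate p q) (hρ : IsCoherent ρ) :
    ∃ C : ℝ, ∀ Y ∈ dualSet q ρ, ‖Y‖ ≤ C := by
  obtain ⟨C, hC0, hC⟩ := hρ.exists_le_mul_norm
  have hq1 : 1 ≤ q := ENNReal.HolderConjugate.one_le q p
  by_cases hp : p = ∞
  -- Here the `L^1` norm of a nonnegative density is its mean.
  · have hq : q = 1 := (ENNReal.HolderConjugate.eq_top_iff_eq_one p q).1 hp
    refine ⟨1, fun Y hY => ?_⟩
    have h0 := hρ.ae_nonneg_of_mem_dualSet hq1 hY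
    have h1 := hρ.integral_eq_one_of_mem_dualSet hY
    subst hq
    rw [Lp.norm_def, eLpNorm_one_eq_lintegral_enorm,
      ← integral_norm_eq_lintegral_enorm (Lp.memLp Y).1, ← h1]
    refine (integral_congr_ae ?_).le
    filter_upwards [h0] with ω hω
    exact Real.norm_of_nonneg hω
  · refine ⟨C, fun Y hY => ?_⟩
    have h0 := hρ.ae_nonneg_of_mem_dualSet hq1 hY
    by_cases hq : q = ∞
    · exact norm_le_of_forall_integral_mul_le_of_eq_one
        ((ENNReal.HolderConjugate.eq_top_iff_eq_one q p).1 hq) hq hC0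
        (fun Z => (hY Z).trans (hC Z)) h0
    · exact norm_le_of_forall_integral_mul_le_of_ne_top hpq hp hq hC0
        (fun Z => (hY Z).trans (hC Z)) h0

end DualNorm

/-! ### Density of simple functions, including `p = ∞` -/

section SimpleDensity

variable {Ω : Type*} [MeasurableSpace Ω] {P : Measure Ω} {p : ℝ≥0∞}

lemma exists_simpleFunc_forall_abs_sub_le {f : Ω → ℝ} (hf : Measurable f) (C : ℝ) {ε : ℝ}
    (hε : 0 < ε) : ∃ s : SimpleFunc Ω ℝ, ∀ ω, |f ω| ≤ C → |f ω - s ω| ≤ ε := by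
  -- Clipping to `[-C, C]` before rounding leaves finitely many values and changes nothing where
  -- `|f| ≤ C`.
  let g : ℝ → ℤ := fun x => ⌊max (-C) (min C x) / ε⌋
  have hg : Measurable g := Int.measurable_floor.comp (by fun_prop)
  have hfin : (Set.range fun ω => g (f ω)).Finite := by
    refine (Set.finite_Icc ⌊-|C| / ε⌋ ⌊|C| / ε⌋).subset ?_
    rintro _ ⟨ω, rfl⟩
    refine ⟨Int.floor_le_floor ?_, Int.floor_le_floor ?_⟩
    · gcongr
      exact (neg_le_neg (le_abs_self C)).trans (le_max_left _ _)
    · gcongr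
      exact max_le (neg_le_abs C) ((min_le_left _ _).trans (le_abs_self C))
  let s : SimpleFunc Ω ℤ := ⟨fun ω => g (f ω), fun k => hg.comp hf (measurableSet_singleton k), hfin⟩
  refine ⟨s.map fun k : ℤ => ε * (k : ℝ), fun ω hω => ?_⟩
  have hclip : max (-C) (min C (f ω)) = f ω := by
    rw [abs_le] at hω
    rw [min_eq_right hω.2, max_eq_right hω.1]
  change |f ω - ε * ⌊max (-C) (min C (f ω)) / ε⌋| ≤ ε
  rw [hclip]
  exact abs_sub_mul_floor_div_le hε _

lemma exists_simpleFunc_norm_sub_le (X : Lp ℝ p P) {ε : ℝ} (hε : 0 < ε) :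
    ∃ (s : SimpleFunc Ω ℝ) (hs : MemLp s p P), ‖X - hs.toLp s‖ ≤ ε := by
  by_cases hp : p = ∞
  · subst hp
    obtain ⟨s, hs⟩ := exists_simpleFunc_forall_abs_sub_le (measurable_coe_lp X) ‖X‖ hε
    have hmem : MemLp s ∞ P := s.memLp_top P
    refine ⟨s, hmem, ?_⟩
    rw [Lp.norm_def]
    refine ENNReal.toReal_le_of_le_ofReal hε.le ?_
    rw [eLpNorm_exponent_top]
    refine eLpNormEssSup_le_of_ae_bound ?_
    filter_upwards [Lp.coeFn_sub X (hmem.toLp s), hmem.coeFn_toLp, ae_le_eLpNormEssSup (f := X)]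
      with ω h1 h2 h3
    rw [h1, Pi.sub_apply, h2, Real.norm_eq_abs]
    refine hs ω ?_
    rw [Lp.norm_def, eLpNorm_exponent_top, ← Real.norm_eq_abs, ← toReal_enorm]
    refine ENNReal.toReal_mono ?_ h3
    rw [← eLpNorm_exponent_top]
    exact Lp.eLpNorm_ne_top X
  · obtain ⟨s, hs, hmem⟩ := (Lp.memLp X).exists_simpleFunc_eLpNorm_sub_lt hp
      (ENNReal.ofReal_pos.2 hε).ne'
    refine ⟨s, hmem, ?_⟩
    rw [Lp.norm_def]
    refine ENNReal.toReal_le_of_le_ofReal hε.le ?_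
    refine le_of_eq_of_le (eLpNorm_congr_ae ?_) hs.le
    exact (Lp.coeFn_sub _ _).trans ((ae_eq_refl _).sub hmem.coeFn_toLp)

end SimpleDensity

/-! ### Dual representation by finite conditioning -/

section DualRepresentation

variable {Ω : Type*} [MeasurableSpace Ω] {P : Measure Ω} {ι : Type*} [Fintype ι]
  [MeasurableSpace ι] [MeasurableSingletonClass ι] {κ : Ω → ι}

lemma integral_mul_comp_fintype (hκ : Measurable κ) {Z : Ω → ℝ} (hZ : Integrable Z P)
    (a : ι → ℝ) : ∫ ω, Z ω * a (κ ω) ∂P = ∑ k, a k * ∫ ω in κ ⁻¹' {k}, Z ω ∂P := by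
  classical
  have hk : ∀ k, MeasurableSet (κ ⁻¹' {k}) := fun k => hκ (measurableSet_singleton k)
  have hpt : ∀ ω, Z ω * a (κ ω) = ∑ k, a k * (κ ⁻¹' {k}).indicator Z ω := by
    intro ω
    rw [Finset.sum_eq_single (κ ω)]
    · rw [Set.indicator_of_mem (by simp), mul_comm]
    · intro k _ hne
      rw [Set.indicator_of_notMem (by simpa using hne.symm), mul_zero]
    · simp
  simp_rw [hpt]
  rw [integral_finsetSum _ fun k _ => (hZ.indicator (hk k)).const_mul _]
  simp_rw [integral_const_mul, integral_indicator (hk _)]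

variable [IsProbabilityMeasure P]

lemma memLp_comp_fintype (r : ℝ≥0∞) (hκ : Measurable κ) (a : ι → ℝ) :
    MemLp (fun ω => a (κ ω)) r P :=
  MemLp.of_bound ((measurable_of_finite a).comp hκ).aestronglyMeasurable (∑ k, ‖a k‖)
    (ae_of_all _ fun ω => Finset.single_le_sum (f := fun k => ‖a k‖) (fun _ _ => norm_nonneg _)
      (Finset.mem_univ (κ ω)))

/-- The embedding into `L^r` of the functions of a random variable with finitely many values. -/
noncomputable def compToLp (P : Measure Ω) [IsProbabilityMeasure P] (r : ℝ≥0∞)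
    (hκ : Measurable κ) : (ι → ℝ) →ₗ[ℝ] Lp ℝ r P where
  toFun a := (memLp_comp_fintype r hκ a).toLp _
  map_add' a b := MemLp.toLp_add (memLp_comp_fintype r hκ a) (memLp_comp_fintype r hκ b)
  map_smul' c a := MemLp.toLp_const_smul c (memLp_comp_fintype r hκ a)

lemma coeFn_compToLp (r : ℝ≥0∞) (hκ : Measurable κ) (a : ι → ℝ) :
    compToLp P r hκ a =ᵐ[P] fun ω => a (κ ω) :=
  (memLp_comp_fintype r hκ a).coeFn_toLp

variable {p q : ℝ≥0∞} [Fact (1 ≤ p)] {ρ : Lp ℝ p P → ℝ}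

/-- A supporting functional `f` composed with conditioning on `κ` factors through a
finite-dimensional space, hence has a density that is a function of `κ`. Monotonicity under
conditioning keeps it below `ρ`, and conditioning fixes functions of `κ`, so contact is kept. -/
lemma IsCoherent.exists_mem_dualSet_of_fintype (hρ : IsCoherent ρ) (hinv : IsLawInvariant ρ)
    (hfatou : p = ∞ → HasFatouProperty ρ) (hP : Nonatomic P) (hκ : Measurable κ) (a : ι → ℝ) :
    ∃ Y ∈ dualSet q ρ,
      ∫ ω, compToLp P p hκ a ω * Y ω ∂P = ρ (compToLp P p hκ a) := by
  classical
  obtain ⟨f, hfa, hfle⟩ := hρ.exists_linear_le (compToLp P p hκ a)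
  let e : ι → ι → ℝ := fun k j => if k = j then 1 else 0
  let F : ι → ℝ := fun k => f (compToLp P p hκ (e k))
  have hsum : ∀ b, f (compToLp P p hκ b) = ∑ k, b k * F k := fun b =>
    LinearMap.pi_apply_eq_sum_univ (f ∘ₗ compToLp P p hκ) b
  -- Density of `f` after conditioning. On a null fibre the quotient is `0` by convention,
  -- harmlessly: the indicator is null there, so `F k = 0`.
  let y : ι → ℝ := fun k => F k / P.real (κ ⁻¹' {k})
  have hint : ∀ Z : Lp ℝ p P, ∫ ω, Z ω * compToLp P q hκ y ω ∂P
      = ∑ k, y k * ∫ ω in κ ⁻¹' {k}, Z ω ∂P := by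
    intro Z
    rw [← integral_mul_comp_fintype hκ ((Lp.memLp Z).integrable Fact.out)]
    exact integral_congr_ae ((ae_eq_refl _).mul (coeFn_compToLp q hκ y))
  refine ⟨compToLp P q hκ y, fun Z => ?_, ?_⟩
  · have h1 := hρ.apply_setAverage_le hinv hfatou hP hκ Z
      (memLp_comp_fintype p hκ fun k => ⨍ x in κ ⁻¹' {k}, Z x ∂P)
    refine le_trans ?_ ((hfle _).trans h1)
    change _ ≤ f (compToLp P p hκ fun k => ⨍ x in κ ⁻¹' {k}, Z x ∂P)
    rw [hint, hsum]
    refine (Finset.sum_congr rfl fun k _ => ?_).le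
    rw [setAverage_eq, smul_eq_mul]
    simp only [y]
    ring
  · rw [hint, ← hfa, hsum]
    refine Finset.sum_congr rfl fun k _ => ?_
    have hk : MeasurableSet (κ ⁻¹' {k}) := hκ (measurableSet_singleton k)
    have hconst : ∫ ω in κ ⁻¹' {k}, compToLp P p hκ a ω ∂P = P.real (κ ⁻¹' {k}) * a k := by
      rw [← smul_eq_mul, ← setIntegral_const]
      refine setIntegral_congr_ae hk ?_
      filter_upwards [coeFn_compToLp p hκ a] with ω hω hωk
      rw [hω, show κ ω = k from hωk]
    rw [hconst]
    by_cases h0 : P (κ ⁻¹' {k}) = 0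
    · have hF : F k = 0 := by
        have : compToLp P p hκ (e k) = 0 := by
          refine Lp.ext ?_
          filter_upwards [coeFn_compToLp p hκ (e k), Lp.coeFn_zero ℝ p P,
            measure_eq_zero_iff_ae_notMem.1 h0] with ω h1 h2 h3
          rw [h1, h2, Pi.zero_apply]
          exact if_neg fun h => h3 h.symm
        simp only [F, this, _root_.map_zero]
      simp [y, hF]
    · have hne : P.real (κ ⁻¹' {k}) ≠ 0 := (measureReal_ne_zero_iff (measure_ne_top _ _)).2 h0
      simp only [y]
      field_simp

lemma IsCoherent.exists_mem_dualSet_of_simpleFunc (hρ : IsCoherent ρ) (hinv : IsLawInvariant ρ)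
    (hfatou : p = ∞ → HasFatouProperty ρ) (hP : Nonatomic P) (s : SimpleFunc Ω ℝ)
    (hs : MemLp s p P) :
    ∃ Y ∈ dualSet q ρ, ∫ ω, hs.toLp s ω * Y ω ∂P = ρ (hs.toLp s) :=
  hρ.exists_mem_dualSet_of_fintype (ι := s.range) hinv hfatou hP
    (κ := fun ω => ⟨s ω, s.mem_range_self ω⟩) (s.measurable.subtype_mk) (fun k => (k : ℝ))

/-- The dual representation of a law-invariant coherent risk measure on a nonatomic space. -/
theorem IsCoherent.isDualSet_dualSet (hpq : ENNReal.HolderConjugate p q) (hρ : IsCoherent ρ)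
    (hinv : IsLawInvariant ρ) (hfatou : p = ∞ → HasFatouProperty ρ) (hP : Nonatomic P) :
    IsDualSet ρ (dualSet q ρ) := by
  refine ⟨hρ.exists_norm_le_of_mem_dualSet hpq,
    fun Y hY => hρ.ae_nonneg_of_mem_dualSet (ENNReal.HolderConjugate.one_le q p) hY,
    fun Y hY => hρ.integral_eq_one_of_mem_dualSet hY, fun X => ⟨?_, fun b hb => ?_⟩⟩
  · rintro _ ⟨Y, hY, rfl⟩
    exact hY X
  · obtain ⟨C, hC0, hC⟩ := hρ.exists_le_mul_norm
    refine le_of_forall_pos_le_add fun δ hδ => ?_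
    -- Replacing `X` by `s` costs at most `C * ‖X - S‖ ≤ δ / 2` twice: once in `ρ`, once in the
    -- pairing with `Y`.
    obtain ⟨s, hs, hsX⟩ := exists_simpleFunc_norm_sub_le X (ε := δ / (2 * (C + 1))) (by positivity)
    obtain ⟨Y, hY, hYs⟩ := hρ.exists_mem_dualSet_of_simpleFunc (q := q) hinv hfatou hP s hs
    set S := hs.toLp s
    have hCδ : C * ‖X - S‖ ≤ δ / 2 := by
      calc C * ‖X - S‖ ≤ (C + 1) * (δ / (2 * (C + 1))) := by gcongr; linarith
        _ = δ / 2 := by field_simp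
    have h1 : ρ X ≤ ρ S + ρ (X - S) := by simpa using hρ.add_le S (X - S)
    have h2 : ∫ ω, S ω * Y ω ∂P = ∫ ω, (S - X : Lp ℝ p P) ω * Y ω ∂P + ∫ ω, X ω * Y ω ∂P := by
      refine Eq.trans (integral_congr_ae ?_) (integral_add
        ((Lp.memLp (S - X)).integrable_mul (Lp.memLp Y))
        ((Lp.memLp X).integrable_mul (Lp.memLp Y)))
      filter_upwards [Lp.coeFn_sub S X] with ω hω
      rw [hω, Pi.sub_apply]
      ring
    have h3 := (hY (S - X)).trans (hC (S - X))
    rw [norm_sub_rev] at h3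
    have h4 : ∫ ω, X ω * Y ω ∂P ≤ b := hb (Set.mem_image_of_mem _ hY)
    linarith [hC (X - S)]

end DualRepresentation

end Licorm

theorem theorem4p2 {Ω : Type*} [MeasurableSpace Ω] (P : Measure Ω) [IsProbabilityMeasure P]
    (p q : ℝ≥0∞) (hpq : ENNReal.HolderConjugate p q) :
    -- the transport problems are well posed
    (∀ R : Set (Measure ℝ), Licorm.IsBoundedFamily q R → ∀ m ∈ Licorm.finiteMoment p,
      (∀ π ∈ Licorm.plans m R, Integrable (fun z : ℝ × ℝ => z.1 * z.2) π) ∧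
      Licorm.chi R m < ⊤) ∧
    -- the optimal transport characterization
    (Licorm.Nonatomic P → ∀ ρ : Lp ℝ p P → ℝ,
      Licorm.IsCoherent ρ → Licorm.IsLawInvariant ρ → (p = ∞ → Licorm.HasFatouProperty ρ) →
      ∃ R : Set (Measure ℝ), Licorm.IsBoundedFamily q R ∧ Licorm.IsNonnegUnitMean R ∧
        ∀ X : Lp ℝ p P, (ρ X : EReal) = Licorm.chi R (Licorm.law X)) ∧
    -- the refined characterization
    (∀ ρ : Lp ℝ p P → ℝ, Licorm.IsCoherent ρ → (p = ∞ → Licorm.HasFatouProperty ρ) →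
      ∀ 𝔜 : Set (Lp ℝ q P), Licorm.IsDualSet ρ 𝔜 →
      ∀ R : Set (Measure ℝ), R = Licorm.law '' 𝔜 →
        (Licorm.IsBoundedFamily q R ∧ Licorm.IsNonnegUnitMean R) ∧
        (∀ X : Lp ℝ p P, (ρ X : EReal) ≤ Licorm.transportRisk R X) ∧
        (Licorm.Nonatomic P → ∀ X : Lp ℝ p P,
          ⨆ X' ∈ {X' : Lp ℝ p P | Licorm.law X' = Licorm.law X}, (ρ X' : EReal)
            = Licorm.transportRisk R X) ∧
        (Licorm.Nonatomic P → Licorm.IsLawInvariant ρ →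
          ∀ X : Lp ℝ p P, (ρ X : EReal) = Licorm.transportRisk R X)) := by
  have hp : p ≠ 0 := ENNReal.HolderConjugate.ne_zero p q
  have hq : q ≠ 0 := ENNReal.HolderConjugate.ne_zero q p
  have : Fact (1 ≤ p) := ⟨ENNReal.HolderConjugate.one_le p q⟩
  refine ⟨fun R hR m hm => ⟨fun π hπ => Licorm.integrable_mul_of_mem_plans hpq hR hm hπ,
    Licorm.chi_lt_top hpq hR hm⟩, fun hP ρ hρ hinv hfatou => ?_, ?_⟩
  · have hdual := hρ.isDualSet_dualSet hpq hinv hfatou hP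
    obtain ⟨C, hC⟩ := hdual.bounded
    exact ⟨Licorm.law '' Licorm.dualSet q ρ, Licorm.isBoundedFamily_image_law hq hC,
      Licorm.isNonnegUnitMean_image_law hdual.nonneg hdual.mean_one,
      hdual.eq_transportRisk hpq hP hinv⟩
  · rintro ρ - - 𝔜 hdual _ rfl
    obtain ⟨C, hC⟩ := hdual.bounded
    exact ⟨⟨Licorm.isBoundedFamily_image_law hq hC,
      Licorm.isNonnegUnitMean_image_law hdual.nonneg hdual.mean_one⟩, hdual.le_transportRisk,
      hdual.iSup_eq_transportRisk hpq, hdual.eq_transportRisk hpq⟩
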